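/- **Setting.** All systems are matrices of real-rational functions of $z$. $\mathcal{RH}_\infty$ (resp. $\mathcal{RL}_\infty$) denotes the proper real-rational matrices with all poles in the open unit disk (resp. without poles on $|z|=1$), $F^*(z)=F^T(z^{-1})$, and $\|F\|_\infty=\sup_{|z|=1}\sigma_{\max}(F(z))$. Let $G$ be an $m\times p$ plant with normalized coprime factorizations $G=N_0M_0^{-1}=\hat M_0^{-1}\hat N_0$, where $M_0,N_0,\hat M_0,\hat N_0\in\mathcal{RH}_\infty$, $$M_0^*M_0+N_0^*N_0=I,\qquad \hat N_0\hat N_0^*+\hat M_0\hat M_0^*=I,$$ and let $X_0,Y_0,\hat X_0,\hat Y_0\in\mathcal{RH}_\infty$ (the corresponding left and right coprime pairs of the controller) satisfy $$\begin{bmatrix}X_0&Y_0\\-\hat N_0&\hat M_0\end{bmatrix}\begin{bmatrix}M_0&-\hat Y_0\\N_0&\hat X_0\end{bmatrix}=I .$$ Let $\Pi\in\mathcal{RH}_\infty$ be an $m\times(p+m)$ privacy filter such that $I-\Pi\begin{bmatrix}-\hat Y_0\\\hat X_0\end{bmatrix}$ is invertible over $\mathcal{RH}_\infty$. Put $$\Psi_0=\Big(I-\Pi\begin{bmatrix}-\hat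 Y_0\\\hat X_0\end{bmatrix}\Big)^{-1}\Pi\begin{bmatrix}M_0\\N_0\end{bmatrix},\quad J_\Delta=\begin{bmatrix}M_0-\hat Y_0\Psi_0\\N_0+\hat X_0\Psi_0\end{bmatrix},\quad K_\Delta=\begin{bmatrix}-\hat N_0&\hat M_0\end{bmatrix}-\Pi .$$ The perturbed plant is $G_\Delta=(N_0+\hat X_0\Psi_0)(M_0-\hat Y_0\Psi_0)^{-1}$. For a pre-filter $\Theta_0\in\mathcal{RH}_\infty$ that normalizes $J_\Delta$, i.e. $(J_\Delta\Theta_0)^*(J_\Delta\Theta_0)=I$, the $\mathcal L_2$-privacy is $$\delta^{\mathcal L_2}(\mathcal I_G,\mathcal I_{G_\Delta})=\inf_{Q\in\mathcal{RL}_\infty}\left\|\begin{bmatrix}M_0\\N_0\end{bmatrix}-J_\Delta\Theta_0Q\right\|_\infty .$$ **Theorem.** There are a normalizing pre-filter $\Theta_0$ and a post-filter $R_N$ with $$R_N^*R_N=(K_\Delta K_\Delta^*)^{-1},$$ both invertible over $\mathcal{RH}_\infty$. For all $\Theta_0,R_N\in\mathcal{RH}_\infty$ with $(J_\Delta\Theta_0)^*(J_\Delta\Theta_0)=I$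 and $R_N^*R_N=(K_\Delta K_\Delta^*)^{-1}$, the filter $\Pi_0=R_N\big(\begin{bmatrix}-\hat N_0&\hat M_0\end{bmatrix}-\Pi\big)$ satisfies $\Pi_0\Pi_0^*=I$ and $$\delta^{\mathcal L_2}(\mathcal I_G,\mathcal I_{G_\Delta})=\left\|\Pi_0\begin{bmatrix}M_0\\N_0\end{bmatrix}\right\|_\infty .$$ If moreover $R_N$ is invertible over $\mathcal{RH}_\infty$ and $M_0-\hat Y_0\Psi_0$ is invertible as a rational matrix (so that $G_\Delta$ is defined), then $\Pi_0$ is a normalized stable kernel representation of $G_\Delta$: $\Pi_0=\begin{bmatrix}-\hat N_\Delta&\hat M_\Delta\end{bmatrix}$ for a left coprime factorization $G_\Delta=\hat M_\Delta^{-1}\hat N_\Delta$ over $\mathcal{RH}_\infty$. -/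

import Mathlib

noncomputable section

/-- Matrices of real-rational transfer functions in the variable `z` (`RatFunc.X`). -/
abbrev TFMatrix (α β : Type*) := Matrix α β (RatFunc ℝ)

/-- A scalar transfer function is proper: the degree of its numerator does not exceed the degree
of its denominator. -/
def IsProperTF (f : RatFunc ℝ) : Prop := f.num.natDegree ≤ f.denom.natDegree

/-- The complex number `z` is not a pole of `f` (`f.denom` is coprime to `f.num`). -/
def NoPoleAt (f : RatFunc ℝ) (z : ℂ) : Prop := Polynomial.aeval z f.denom ≠ 0

/-- `RH∞`: real-rational, proper, all poles in the open unit disk (entrywise). -/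
def IsRHInf {α β : Type*} (F : TFMatrix α β) : Prop :=
  ∀ i j, IsProperTF (F i j) ∧ ∀ z : ℂ, 1 ≤ ‖z‖ → NoPoleAt (F i j) z

/-- `RL∞`: real-rational, proper, no poles on the unit circle (entrywise). -/
def IsRLInf {α β : Type*} (F : TFMatrix α β) : Prop :=
  ∀ i j, IsProperTF (F i j) ∧ ∀ z : ℂ, ‖z‖ = 1 → NoPoleAt (F i j) z

/-- A square transfer matrix that is invertible over `RH∞`. -/
def IsRHInfUnit {α : Type*} [Fintype α] [DecidableEq α] (F : TFMatrix α α) : Prop :=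
  IsRHInf F ∧ ∃ H : TFMatrix α α, IsRHInf H ∧ F * H = 1 ∧ H * F = 1

/-- The conjugate `F*(z) = Fᵀ(z⁻¹)`. -/
def conjTF {α β : Type*} (F : TFMatrix α β) : TFMatrix β α :=
  F.transpose.map fun f => f.eval (RatFunc.C (K := ℝ)) (RatFunc.X)⁻¹

/-- The complex matrix `F(z)`. -/
def evalTF {α β : Type*} (F : TFMatrix α β) (z : ℂ) : Matrix α β ℂ :=
  F.map fun f => f.eval (algebraMap ℝ ℂ) z

open scoped Matrix.Norms.L2Operator in
/-- `‖F‖∞ = sup_{|z| = 1} σ_max (F(z))`, the largest singular value being the operator norm with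
respect to the Euclidean norms; a maximum for every `F` without poles on the unit circle. -/
def hInfNorm {α β : Type*} [Fintype α] [Fintype β] [DecidableEq β] (F : TFMatrix α β) : ℝ :=
  ⨆ z : Metric.sphere (0 : ℂ) 1, ‖evalTF F z‖

variable {p m : ℕ}

/-- `(M, N)` and `(M̂, N̂)` are right and left coprime factorizations of `G` over `RH∞`, which
together with `(X, Y)` and `(X̂, Ŷ)` satisfy the double Bezout identity. -/
structure IsDoublyCoprime (G : TFMatrix (Fin m) (Fin p))
    (M : TFMatrix (Fin p) (Fin p)) (N : TFMatrix (Fin m) (Fin p))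
    (Mh : TFMatrix (Fin m) (Fin m)) (Nh : TFMatrix (Fin m) (Fin p))
    (X : TFMatrix (Fin p) (Fin p)) (Y : TFMatrix (Fin p) (Fin m))
    (Xh : TFMatrix (Fin m) (Fin m)) (Yh : TFMatrix (Fin p) (Fin m)) : Prop where
  stable_M : IsRHInf M
  stable_N : IsRHInf N
  stable_Mh : IsRHInf Mh
  stable_Nh : IsRHInf Nh
  stable_X : IsRHInf X
  stable_Y : IsRHInf Y
  stable_Xh : IsRHInf Xh
  stable_Yh : IsRHInf Yh
  isUnit_M : IsUnit M
  isUnit_Mh : IsUnit Mh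
  rcf : G = N * M⁻¹
  lcf : G = Mh⁻¹ * Nh
  bezout : Matrix.fromBlocks X Y (-Nh) Mh * Matrix.fromBlocks M (-Yh) N Xh = 1

/-- The image representation `[M; N]`. -/
def imageRep (M : TFMatrix (Fin p) (Fin p)) (N : TFMatrix (Fin m) (Fin p)) :
    TFMatrix (Fin p ⊕ Fin m) (Fin p) := Matrix.fromRows M N

/-- The kernel representation `[-N̂ M̂]`. -/
def kernelRep (Mh : TFMatrix (Fin m) (Fin m)) (Nh : TFMatrix (Fin m) (Fin p)) :
    TFMatrix (Fin m) (Fin p ⊕ Fin m) := Matrix.fromCols (-Nh) Mh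

/-- The column `[-Ŷ; X̂]` belonging to the controller. -/
def residualRep (Xh : TFMatrix (Fin m) (Fin m)) (Yh : TFMatrix (Fin p) (Fin m)) :
    TFMatrix (Fin p ⊕ Fin m) (Fin m) := Matrix.fromRows (-Yh) Xh

/-- `K` is a normalized stable kernel representation of `G`: `K = [-N̂ M̂]` for a left coprime
factorization `G = M̂⁻¹ N̂` over `RH∞`, and `K K* = I`. -/
def IsNormalizedSKR (G : TFMatrix (Fin m) (Fin p)) (K : TFMatrix (Fin m) (Fin p ⊕ Fin m)) : Prop :=
  ∃ (Mh : TFMatrix (Fin m) (Fin m)) (Nh : TFMatrix (Fin m) (Fin p))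
    (Xh : TFMatrix (Fin m) (Fin m)) (Yh : TFMatrix (Fin p) (Fin m)),
    K = kernelRep Mh Nh ∧ IsRHInf Mh ∧ IsRHInf Nh ∧ IsRHInf Xh ∧ IsRHInf Yh ∧
    IsUnit Mh ∧ G = Mh⁻¹ * Nh ∧ kernelRep Mh Nh * residualRep Xh Yh = 1 ∧ K * conjTF K = 1

/-- `Ψ = (I - Π [-Ŷ; X̂])⁻¹ Π [M; N]` for the privacy filter `Π` (here `P`). -/
def privacyPsi (M : TFMatrix (Fin p) (Fin p)) (N : TFMatrix (Fin m) (Fin p))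
    (Xh : TFMatrix (Fin m) (Fin m)) (Yh : TFMatrix (Fin p) (Fin m))
    (P : TFMatrix (Fin m) (Fin p ⊕ Fin m)) : TFMatrix (Fin m) (Fin p) :=
  (1 - P * residualRep Xh Yh)⁻¹ * (P * imageRep M N)

/-- `M + Δ_M = M - Ŷ Ψ`. -/
def perturbedM (M : TFMatrix (Fin p) (Fin p)) (N : TFMatrix (Fin m) (Fin p))
    (Xh : TFMatrix (Fin m) (Fin m)) (Yh : TFMatrix (Fin p) (Fin m))
    (P : TFMatrix (Fin m) (Fin p ⊕ Fin m)) : TFMatrix (Fin p) (Fin p) :=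
  M - Yh * privacyPsi M N Xh Yh P

/-- `N + Δ_N = N + X̂ Ψ`. -/
def perturbedN (M : TFMatrix (Fin p) (Fin p)) (N : TFMatrix (Fin m) (Fin p))
    (Xh : TFMatrix (Fin m) (Fin m)) (Yh : TFMatrix (Fin p) (Fin m))
    (P : TFMatrix (Fin m) (Fin p ⊕ Fin m)) : TFMatrix (Fin m) (Fin p) :=
  N + Xh * privacyPsi M N Xh Yh P

/-- The image representation `[M - Ŷ Ψ; N + X̂ Ψ]` of the perturbed plant. -/
def perturbedImageRep (M : TFMatrix (Fin p) (Fin p)) (N : TFMatrix (Fin m) (Fin p))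
    (Xh : TFMatrix (Fin m) (Fin m)) (Yh : TFMatrix (Fin p) (Fin m))
    (P : TFMatrix (Fin m) (Fin p ⊕ Fin m)) : TFMatrix (Fin p ⊕ Fin m) (Fin p) :=
  imageRep (perturbedM M N Xh Yh P) (perturbedN M N Xh Yh P)

/-- The perturbed plant `G_Δ = (N + X̂ Ψ) (M - Ŷ Ψ)⁻¹`. -/
def perturbedPlant (M : TFMatrix (Fin p) (Fin p)) (N : TFMatrix (Fin m) (Fin p))
    (Xh : TFMatrix (Fin m) (Fin m)) (Yh : TFMatrix (Fin p) (Fin m))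
    (P : TFMatrix (Fin m) (Fin p ⊕ Fin m)) : TFMatrix (Fin m) (Fin p) :=
  perturbedN M N Xh Yh P * (perturbedM M N Xh Yh P)⁻¹

/-- A pre-filter `Θ ∈ RH∞` normalizes the image representation `J`: `(J Θ)* (J Θ) = I`. -/
def IsNormalizingPrefilter (J : TFMatrix (Fin p ⊕ Fin m) (Fin p))
    (Θ : TFMatrix (Fin p) (Fin p)) : Prop :=
  IsRHInf Θ ∧ conjTF (J * Θ) * (J * Θ) = 1

/-- A post-filter `R ∈ RH∞` normalizes the kernel representation `K`: `R* R = (K K*)⁻¹`. -/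
def IsNormalizingPostfilter (K : TFMatrix (Fin m) (Fin p ⊕ Fin m))
    (R : TFMatrix (Fin m) (Fin m)) : Prop :=
  IsRHInf R ∧ conjTF R * R = (K * conjTF K)⁻¹

/-- `inf_{Q ∈ RL∞} ‖J₁ - J₂ Q‖∞`, the gap between the image subspaces of two normalized image
representations. -/
def gapL2 (J₁ J₂ : TFMatrix (Fin p ⊕ Fin m) (Fin p)) : ℝ :=
  ⨅ Q : {Q : TFMatrix (Fin p) (Fin p) // IsRLInf Q}, hInfNorm (J₁ - J₂ * Q.1)

end

/-! Put T = I - Π[-Ŷ₀; X̂₀]. By the Bezout identity K_Δ[-Ŷ₀; X̂₀] = T and K_Δ[M₀; N₀] = -Π[M₀; N₀],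
so Ψ₀ is exactly what makes K_Δ J_Δ = 0. The same identity gives stable one-sided inverses, [X₀ Y₀]
J_Δ = I and K_Δ [-Ŷ₀; X̂₀] T⁻¹ = I. Hence J_Δ* J_Δ and K_Δ K_Δ* are positive definite on the circle,
and their spectral factors, invertible over RH∞, yield Θ₀ and R_N
(`exists_isRHInfUnit_spectral_factor`).

For the distance write J = J_Δ Θ₀. From J*J = I, Π₀Π₀* = I and Π₀J = 0 it follows that J J* + Π₀*Π₀
= I, because the matrices involved are square. Multiplication by Π₀ is contractive and kills JQ, so
‖Π₀[M₀; N₀]‖∞ is a lower bound. It would be attained at Q = J*[M₀; N₀], which may be improper;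
multiples fQ that are proper, with f close to 1 on the circle, approach the bound
(`gapL2_eq_hInfNorm`).

Spectral factorization is proved from scratch. After z ↦ z⁻¹ and clearing of denominators the task
is to factor N N* for a polynomial N of degree at most d. With the weight W = (N N*)⁻¹, the normal
equations give A = I + c₁z + … + c_d z^d that is W-orthogonal to z, …, z^d. Then W A has no positive
powers of z at all, so A*W A is analytic in the disk and self-conjugate, hence a constant LᵀL, and V
= A L⁻¹ is the factor. The analytic input is the mean value property and the positivity of the mean
of |f|² over the circle. -/

noncomputable section

open Polynomial

/-! ### Rational functions regular on a set, and their values -/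

/-- The rational functions without poles in a set `S`. -/
def regularOn (S : Set ℂ) : Subalgebra ℝ (RatFunc ℝ) where
  carrier := {f | ∀ z ∈ S, NoPoleAt f z}
  mul_mem' := fun {f g} hf hg z hz => by
    obtain ⟨r, hr⟩ := RatFunc.denom_mul_dvd f g
    have h := mul_ne_zero (hf z hz) (hg z hz)
    rw [← map_mul, hr, map_mul] at h
    exact left_ne_zero_of_mul h
  add_mem' := fun {f g} hf hg z hz => by
    obtain ⟨r, hr⟩ := RatFunc.denom_add_dvd f g
    have h := mul_ne_zero (hf z hz) (hg z hz)
    rw [← map_mul, hr, map_mul] at h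
    exact left_ne_zero_of_mul h
  algebraMap_mem' := fun c z _ => by
    simp [RatFunc.algebraMap_eq_C, NoPoleAt, RatFunc.denom_C]

theorem regularOn_mono {S T : Set ℂ} (h : S ⊆ T) : regularOn T ≤ regularOn S :=
  fun _ hf z hz => hf z (h hz)

theorem div_mem_regularOn {S : Set ℂ} (p : ℝ[X]) {q : ℝ[X]} (hq : ∀ z ∈ S, aeval z q ≠ 0) :
    algebraMap ℝ[X] (RatFunc ℝ) p / algebraMap ℝ[X] (RatFunc ℝ) q ∈ regularOn S := by
  intro z hz
  obtain ⟨r, hr⟩ := RatFunc.denom_div_dvd p q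
  have h := hq z hz
  rw [hr, map_mul] at h
  exact left_ne_zero_of_mul h

theorem algebraMap_mem_regularOn (S : Set ℂ) (p : ℝ[X]) :
    algebraMap ℝ[X] (RatFunc ℝ) p ∈ regularOn S := by
  simpa using div_mem_regularOn (S := S) p (q := 1) (by simp)

theorem X_mem_regularOn (S : Set ℂ) : RatFunc.X ∈ regularOn S := by
  simpa using algebraMap_mem_regularOn S X

theorem C_mem_regularOn (S : Set ℂ) (c : ℝ) : RatFunc.C c ∈ regularOn S :=
  (regularOn S).algebraMap_mem c

/-- The value of a rational function at a complex number. -/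
abbrev evalAt (z : ℂ) (f : RatFunc ℝ) : ℂ := f.eval (algebraMap ℝ ℂ) z

theorem evalAt_add {f g : RatFunc ℝ} {z : ℂ} (hf : NoPoleAt f z) (hg : NoPoleAt g z) :
    evalAt z (f + g) = evalAt z f + evalAt z g := RatFunc.eval_add _ _ hf hg

theorem evalAt_mul {f g : RatFunc ℝ} {z : ℂ} (hf : NoPoleAt f z) (hg : NoPoleAt g z) :
    evalAt z (f * g) = evalAt z f * evalAt z g := RatFunc.eval_mul _ _ hf hg

theorem evalAt_algebraMap (z : ℂ) (p : ℝ[X]) :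
    evalAt z (algebraMap ℝ[X] (RatFunc ℝ) p) = aeval z p := by
  simp [evalAt, RatFunc.eval, aeval_def]

theorem evalAt_div {p q : ℝ[X]} {z : ℂ} (hq : aeval z q ≠ 0) :
    evalAt z (algebraMap ℝ[X] (RatFunc ℝ) p / algebraMap ℝ[X] (RatFunc ℝ) q) =
      aeval z p / aeval z q := by
  have hq0 : algebraMap ℝ[X] (RatFunc ℝ) q ≠ 0 :=
    RatFunc.algebraMap_ne_zero fun h => hq (by simp [h])
  have h1 := div_mem_regularOn (S := {z}) p (q := q) (by simpa using hq)
  have h2 := algebraMap_mem_regularOn {z} q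
  rw [eq_div_iff hq, ← evalAt_algebraMap z q, ← evalAt_mul (h1 z rfl) (h2 z rfl),
    div_mul_cancel₀ _ hq0, evalAt_algebraMap]

/-- Evaluation at a point of `S` as an algebra homomorphism. -/
def evalHom {S : Set ℂ} {z : ℂ} (hz : z ∈ S) : regularOn S →ₐ[ℝ] ℂ where
  toFun f := evalAt z f.1
  map_one' := RatFunc.eval_one _ _
  map_mul' f g := evalAt_mul (f.2 z hz) (g.2 z hz)
  map_zero' := RatFunc.eval_zero _ _
  map_add' f g := evalAt_add (f.2 z hz) (g.2 z hz)
  commutes' c := by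
    change evalAt z (algebraMap ℝ (RatFunc ℝ) c) = _
    rw [RatFunc.algebraMap_eq_C]; exact RatFunc.eval_C _ _

theorem inv_mem_regularOn {S : Set ℂ} {f : RatFunc ℝ} (hf : f ∈ regularOn S)
    (h0 : ∀ z ∈ S, evalAt z f ≠ 0) : f⁻¹ ∈ regularOn S := by
  rw [← RatFunc.num_div_denom f, inv_div]
  refine div_mem_regularOn _ fun z hz h => h0 z hz ?_
  rw [← RatFunc.num_div_denom f, evalAt_div (hf z hz), h, zero_div]

/-! ### The substitution z ↦ z⁻¹ -/

theorem aeval_X_inv_injective :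
    Function.Injective (aeval (RatFunc.X⁻¹ : RatFunc ℝ) : ℝ[X] →ₐ[ℝ] RatFunc ℝ) := by
  rw [← transcendental_iff_injective]
  intro h
  have := h.inv
  rw [inv_inv] at this
  exact RatFunc.transcendental_X this

/-- The substitution `z ↦ z⁻¹` on rational functions. -/
def invSubst : RatFunc ℝ →ₐ[ℝ] RatFunc ℝ :=
  RatFunc.liftAlgHom (aeval (RatFunc.X⁻¹ : RatFunc ℝ))
    (nonZeroDivisors_le_comap_nonZeroDivisors_of_injective _ aeval_X_inv_injective)

theorem invSubst_apply (f : RatFunc ℝ) :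
    invSubst f = f.eval (RatFunc.C (K := ℝ)) (RatFunc.X)⁻¹ := by
  rw [invSubst, RatFunc.liftAlgHom_apply]
  rfl

theorem invSubst_div (p q : ℝ[X]) :
    invSubst (algebraMap ℝ[X] (RatFunc ℝ) p / algebraMap ℝ[X] (RatFunc ℝ) q) =
      aeval (RatFunc.X⁻¹ : RatFunc ℝ) p / aeval (RatFunc.X⁻¹ : RatFunc ℝ) q :=
  RatFunc.liftAlgHom_apply_div _ _ _ _

theorem invSubst_algebraMap (p : ℝ[X]) :
    invSubst (algebraMap ℝ[X] (RatFunc ℝ) p) = aeval (RatFunc.X⁻¹ : RatFunc ℝ) p := by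
  simpa using invSubst_div p 1

@[simp] theorem invSubst_X : invSubst RatFunc.X = RatFunc.X⁻¹ := by
  rw [← RatFunc.algebraMap_X, invSubst_algebraMap, aeval_X, RatFunc.algebraMap_X]

@[simp] theorem invSubst_C (c : ℝ) : invSubst (RatFunc.C c) = RatFunc.C c :=
  invSubst.commutes c

@[simp] theorem invSubst_invSubst (f : RatFunc ℝ) : invSubst (invSubst f) = f := by
  have key : ∀ p : ℝ[X], invSubst (aeval (RatFunc.X⁻¹ : RatFunc ℝ) p) = algebraMap _ _ p := by
    intro p
    rw [← Polynomial.aeval_algHom_apply, map_inv₀, invSubst_X, inv_inv,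
      RatFunc.aeval_X_left_eq_algebraMap]
  rw [← RatFunc.num_div_denom f, invSubst_div, map_div₀, key, key]


theorem aeval_reflect {K : Type*} [Field K] [Algebra ℝ K] {p : ℝ[X]} {d : ℕ}
    (hd : p.natDegree ≤ d) {z : K} (hz : z ≠ 0) :
    aeval z (reflect d p) = z ^ d * aeval z⁻¹ p := by
  have : Invertible z⁻¹ := invertibleOfNonzero (inv_ne_zero hz)
  have h := Polynomial.eval₂_reflect_mul_pow (algebraMap ℝ K) z⁻¹ d p hd
  rw [invOf_eq_inv, inv_inv] at h
  rw [aeval_def, aeval_def, ← h, inv_pow, mul_comm _ (z ^ d)⁻¹,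
    mul_inv_cancel_left₀ (pow_ne_zero _ hz)]

/-- Reflecting both polynomials at the same `d` produces the same factor `X ^ d` twice, and it
cancels in the quotient. -/
theorem invSubst_div_eq_reflect {p q : ℝ[X]} {d : ℕ} (hp : p.natDegree ≤ d)
    (hq : q.natDegree ≤ d) :
    invSubst (algebraMap ℝ[X] (RatFunc ℝ) p / algebraMap ℝ[X] (RatFunc ℝ) q) =
      algebraMap ℝ[X] (RatFunc ℝ) (reflect d p) / algebraMap ℝ[X] (RatFunc ℝ) (reflect d q) := by
  rw [invSubst_div, ← RatFunc.aeval_X_left_eq_algebraMap, ← RatFunc.aeval_X_left_eq_algebraMap,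
    aeval_reflect hp RatFunc.X_ne_zero, aeval_reflect hq RatFunc.X_ne_zero,
    mul_div_mul_left _ _ (pow_ne_zero _ RatFunc.X_ne_zero)]

theorem noPoleAt_invSubst {f : RatFunc ℝ} {z : ℂ} (hz : z ≠ 0) (hf : NoPoleAt f z⁻¹) :
    NoPoleAt (invSubst f) z ∧ evalAt z (invSubst f) = evalAt z⁻¹ f := by
  set d := max f.num.natDegree f.denom.natDegree
  have h1 : f.num.natDegree ≤ d := le_max_left _ _
  have h2 : f.denom.natDegree ≤ d := le_max_right _ _
  have h3 : aeval z (reflect d f.denom) ≠ 0 := by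
    rw [aeval_reflect h2 hz]
    exact mul_ne_zero (pow_ne_zero _ hz) hf
  have h4 : invSubst f = algebraMap ℝ[X] (RatFunc ℝ) (reflect d f.num) /
      algebraMap ℝ[X] (RatFunc ℝ) (reflect d f.denom) := by
    conv_lhs => rw [← RatFunc.num_div_denom f]
    exact invSubst_div_eq_reflect h1 h2
  constructor
  · rw [h4]
    exact div_mem_regularOn (S := {z}) _ (by simpa using h3) z rfl
  · rw [h4, evalAt_div h3, aeval_reflect h1 hz, aeval_reflect h2 hz,
      mul_div_mul_left _ _ (pow_ne_zero _ hz), ← evalAt_div hf, RatFunc.num_div_denom]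

theorem noPoleAt_conj {f : RatFunc ℝ} {z : ℂ} (hf : NoPoleAt f z) :
    NoPoleAt f (starRingEnd ℂ z) := by
  unfold NoPoleAt
  rw [aeval_conj]
  exact (_root_.map_ne_zero _).2 hf

theorem evalAt_conj (f : RatFunc ℝ) (z : ℂ) :
    evalAt (starRingEnd ℂ z) f = starRingEnd ℂ (evalAt z f) := by
  simp only [evalAt, RatFunc.eval, ← aeval_def, aeval_conj, map_div₀]

/-- On the circle z⁻¹ is the conjugate of z, and the coefficients are real. This is why `conjTF` is
the pointwise conjugate transpose there. -/
theorem evalAt_invSubst {f : RatFunc ℝ} {z : ℂ} (hz : ‖z‖ = 1) (hf : NoPoleAt f z) :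
    NoPoleAt (invSubst f) z ∧ evalAt z (invSubst f) = starRingEnd ℂ (evalAt z f) := by
  have hz0 : z ≠ 0 := by rintro rfl; simp at hz
  have hc : z⁻¹ = starRingEnd ℂ z := by
    rw [Complex.inv_def, Complex.normSq_eq_norm_sq, hz]; simp
  rw [← evalAt_conj, ← hc]
  exact noPoleAt_invSubst hz0 (hc ▸ noPoleAt_conj hf)

/-! ### Properness, stability and analyticity in the disk -/

theorem isProperTF_div {a b : ℝ[X]} (hb : b ≠ 0) (h : a.natDegree ≤ b.natDegree) :
    IsProperTF (algebraMap ℝ[X] (RatFunc ℝ) a / algebraMap ℝ[X] (RatFunc ℝ) b) := by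
  set f := algebraMap ℝ[X] (RatFunc ℝ) a / algebraMap ℝ[X] (RatFunc ℝ) b with hf
  have e : f.num * b = a * f.denom := (RatFunc.num_mul_eq_mul_denom_iff hb).2 hf
  unfold IsProperTF
  rcases eq_or_ne f.num 0 with h0 | h0
  · simp [h0]
  · have ha : a ≠ 0 := by
      rintro rfl
      rw [zero_mul] at e
      exact mul_ne_zero h0 hb e
    have := congrArg natDegree e
    rw [natDegree_mul h0 hb, natDegree_mul ha f.denom_ne_zero] at this
    omega

/-- The rational functions without poles in the closed unit disk. -/
abbrev diskAlg : Subalgebra ℝ (RatFunc ℝ) := regularOn (Metric.closedBall 0 1)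

/-- The rational functions without poles on the unit circle. -/
abbrev circleAlg : Subalgebra ℝ (RatFunc ℝ) := regularOn (Metric.sphere 0 1)

theorem diskAlg_le_circleAlg : diskAlg ≤ circleAlg :=
  regularOn_mono Metric.sphere_subset_closedBall

theorem invSubst_mem_circleAlg {f : RatFunc ℝ} (hf : f ∈ circleAlg) : invSubst f ∈ circleAlg :=
  fun z hz => (evalAt_invSubst (by simpa using hz) (hf z hz)).1

theorem invSubst_div_mem_diskAlg {p q : ℝ[X]} (hpq : p.natDegree ≤ q.natDegree)
    (hq : ∀ z : ℂ, 1 ≤ ‖z‖ → aeval z q ≠ 0) :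
    invSubst (algebraMap ℝ[X] (RatFunc ℝ) p / algebraMap ℝ[X] (RatFunc ℝ) q) ∈ diskAlg := by
  rw [invSubst_div_eq_reflect hpq le_rfl]
  refine div_mem_regularOn _ fun z hz => ?_
  rw [Metric.mem_closedBall, dist_zero_right] at hz
  rcases eq_or_ne z 0 with rfl | h0
  · have hq0 : q ≠ 0 := fun h => hq 1 (by simp) (by simp [h])
    -- At 0 the reflected denominator takes the leading coefficient of `q` as its value; this is
    -- where properness enters.
    simp [aeval_def, eval₂_at_zero, coeff_reflect, hq0]
  · rw [aeval_reflect le_rfl h0]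
    exact mul_ne_zero (pow_ne_zero _ h0)
      (hq _ (by rw [norm_inv]; exact (one_le_inv₀ (norm_pos_iff.2 h0)).2 hz))

/-- The substitution exchanges ∞ with 0 and the exterior with the punctured disk, so properness
becomes the absence of a pole at 0. -/
theorem isRHInf_entry_iff {f : RatFunc ℝ} :
    (IsProperTF f ∧ ∀ z : ℂ, 1 ≤ ‖z‖ → NoPoleAt f z) ↔ invSubst f ∈ diskAlg := by
  constructor
  · rintro ⟨h1, h2⟩
    rw [← RatFunc.num_div_denom f]
    exact invSubst_div_mem_diskAlg h1 h2
  · intro h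
    set g := invSubst f with hg
    have hfg : f = invSubst g := by rw [hg, invSubst_invSubst]
    set d := max g.num.natDegree g.denom.natDegree
    have h1 : g.num.natDegree ≤ d := le_max_left _ _
    have h2 : g.denom.natDegree ≤ d := le_max_right _ _
    constructor
    · have h0 : g.denom.coeff 0 ≠ 0 := by
        have := h 0 (by simp)
        simpa [NoPoleAt, aeval_def, eval₂_at_zero] using this
      -- The nonzero constant coefficient of `g.denom` is moved to degree `d`.
      have h3 : d ≤ (reflect d g.denom).natDegree :=
        le_natDegree_of_ne_zero (by simpa [coeff_reflect] using h0)
      rw [hfg, ← RatFunc.num_div_denom g, invSubst_div_eq_reflect h1 h2]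
      refine isProperTF_div ?_ ?_
      · rw [Ne, reflect_eq_zero_iff]; exact g.denom_ne_zero
      · exact (natDegree_reflect_le ..).trans ((max_le le_rfl h1).trans h3)
    · intro z hz
      have hz0 : z ≠ 0 := by rintro rfl; simp at hz; linarith
      rw [hfg]
      refine (noPoleAt_invSubst hz0 (h _ ?_)).1
      rw [Metric.mem_closedBall, dist_zero_right, norm_inv]
      exact inv_le_one_of_one_le₀ hz

/-! ### Means over the unit circle -/

theorem continuousOn_evalAt {S : Set ℂ} {f : RatFunc ℝ} (hf : f ∈ regularOn S) :
    ContinuousOn (fun z => evalAt z f) S := by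
  simp only [evalAt, RatFunc.eval, ← aeval_def]
  exact ContinuousOn.div f.num.continuous_aeval.continuousOn f.denom.continuous_aeval.continuousOn hf

theorem differentiableOn_evalAt {S : Set ℂ} {f : RatFunc ℝ} (hf : f ∈ regularOn S) :
    DifferentiableOn ℂ (fun z => evalAt z f) S := by
  simp only [evalAt, RatFunc.eval, ← aeval_def]
  exact DifferentiableOn.div f.num.differentiable_aeval.differentiableOn
    f.denom.differentiable_aeval.differentiableOn hf

/-- The mean of (the real part of) a rational function over the unit circle. -/
def circleMean (f : RatFunc ℝ) : ℝ := Real.circleAverage (fun z => (evalAt z f).re) 0 1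

theorem circleIntegrable_re_evalAt {f : RatFunc ℝ} (hf : f ∈ circleAlg) :
    CircleIntegrable (fun z => (evalAt z f).re) 0 1 :=
  ContinuousOn.circleIntegrable zero_le_one
    (Complex.continuous_re.comp_continuousOn (continuousOn_evalAt hf))

theorem circleMean_add {f g : RatFunc ℝ} (hf : f ∈ circleAlg) (hg : g ∈ circleAlg) :
    circleMean (f + g) = circleMean f + circleMean g := by
  rw [circleMean, circleMean, circleMean,
    ← Real.circleAverage_fun_add (circleIntegrable_re_evalAt hf) (circleIntegrable_re_evalAt hg)]
  refine Real.circleAverage_congr_sphere fun z hz => ?_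
  rw [abs_one] at hz
  simp only [evalAt_add (hf z hz) (hg z hz), Complex.add_re]

theorem circleMean_C (c : ℝ) : circleMean (RatFunc.C c) = c := by
  simp [circleMean, Real.circleAverage_const]

theorem circleMean_C_mul (c : ℝ) {f : RatFunc ℝ} (hf : f ∈ circleAlg) :
    circleMean (RatFunc.C c * f) = c * circleMean f := by
  rw [circleMean, circleMean, ← smul_eq_mul c (Real.circleAverage _ _ _),
    ← Real.circleAverage_fun_smul]
  refine Real.circleAverage_congr_sphere fun z hz => ?_
  rw [abs_one] at hz
  simp only [evalAt_mul (C_mem_regularOn _ c z hz) (hf z hz)]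
  simp

theorem circleMean_sum {ι : Type*} (s : Finset ι) {f : ι → RatFunc ℝ}
    (hf : ∀ i ∈ s, f i ∈ circleAlg) : circleMean (∑ i ∈ s, f i) = ∑ i ∈ s, circleMean (f i) := by
  classical
  induction s using Finset.induction_on with
  | empty => simpa using circleMean_C 0
  | insert a s ha ih =>
    have h2 : ∀ i ∈ s, f i ∈ circleAlg := fun i hi => hf i (Finset.mem_insert_of_mem hi)
    rw [Finset.sum_insert ha, Finset.sum_insert ha,
      circleMean_add (hf a (Finset.mem_insert_self a s)) (Subalgebra.sum_mem _ h2), ih h2]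

theorem circleMean_invSubst {f : RatFunc ℝ} (hf : f ∈ circleAlg) :
    circleMean (invSubst f) = circleMean f := by
  refine Real.circleAverage_congr_sphere fun z hz => ?_
  rw [abs_one] at hz
  simp [(evalAt_invSubst (by simpa using hz) (hf z hz)).2]

/-- By the mean value property the mean is the value at 0. All later vanishing arguments bring a
mean into this form. -/
theorem circleMean_X_mul {f : RatFunc ℝ} (hf : f ∈ diskAlg) :
    circleMean (RatFunc.X * f) = 0 := by
  have h1 : RatFunc.X * f ∈ diskAlg := mul_mem (X_mem_regularOn _) hf
  have h2 : DiffContOnCl ℂ (fun z => evalAt z (RatFunc.X * f)) (Metric.ball 0 |1|) := by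
    refine DifferentiableOn.diffContOnCl ?_
    rw [abs_one, closure_ball _ one_ne_zero]
    exact differentiableOn_evalAt h1
  have h3 : Real.circleAverage (fun z => evalAt z (RatFunc.X * f)) 0 1 = 0 := by
    rw [h2.circleAverage, evalAt_mul (X_mem_regularOn {0} 0 rfl) (hf 0 (by simp))]
    simp
  have h4 := Complex.reCLM.circleAverage_comp_comm
    (ContinuousOn.circleIntegrable zero_le_one
      (continuousOn_evalAt (diskAlg_le_circleAlg h1)))
  rw [h3, map_zero] at h4
  exact h4

theorem exists_evalAt_ne_zero {f : RatFunc ℝ} (hf : f ∈ circleAlg) (h0 : f ≠ 0) :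
    ∃ z ∈ Metric.sphere (0 : ℂ) 1, evalAt z f ≠ 0 := by
  by_contra! h
  have hinf : (Metric.sphere (0 : ℂ) 1).Infinite := by
    refine Set.infinite_of_injOn_mapsTo (f := fun t : ℝ => circleMap 0 1 t)
      (s := Set.Ico 0 (2 * Real.pi)) ?_ (fun t _ => circleMap_mem_sphere _ zero_le_one t)
      (Set.Ico_infinite Real.two_pi_pos)
    exact injOn_circleMap_of_abs_sub_le' one_ne_zero (by simp)
  refine RatFunc.num_ne_zero h0 ?_
  have : f.num.map (algebraMap ℝ ℂ) = 0 := by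
    refine Polynomial.eq_zero_of_infinite_isRoot _ (hinf.mono fun z hz => ?_)
    have := h z hz
    rw [← RatFunc.num_div_denom f, evalAt_div (hf z hz), div_eq_zero_iff] at this
    have := this.resolve_right (hf z hz)
    rwa [aeval_def, ← eval_map] at this
  exact (Polynomial.map_eq_zero _).1 this

theorem evalAt_invSubst_mul_self {f : RatFunc ℝ} (hf : f ∈ circleAlg) {z : ℂ}
    (hz : z ∈ Metric.sphere (0 : ℂ) 1) :
    (evalAt z (invSubst f * f)).re = ‖evalAt z f‖ ^ 2 := by
  have h := evalAt_invSubst (by simpa using hz) (hf z hz)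
  rw [evalAt_mul h.1 (hf z hz), h.2, Complex.conj_mul', ← Complex.ofReal_pow, Complex.ofReal_re]

theorem circleMean_invSubst_mul_self_nonneg {f : RatFunc ℝ} (hf : f ∈ circleAlg) :
    0 ≤ circleMean (invSubst f * f) := by
  refine Real.circleAverage_nonneg_of_nonneg fun z hz => ?_
  rw [abs_one] at hz
  rw [evalAt_invSubst_mul_self hf hz]
  positivity

/-- The integrand is |f|², continuous and nonnegative, and a nonzero `f` has only finitely many
zeros on the circle. -/
theorem circleMean_invSubst_mul_self_pos {f : RatFunc ℝ} (hf : f ∈ circleAlg) (h0 : f ≠ 0) :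
    0 < circleMean (invSubst f * f) := by
  obtain ⟨z, hz, hfz⟩ := exists_evalAt_ne_zero hf h0
  have hz' := hz
  rw [← abs_one (α := ℝ), ← image_circleMap_Ioc] at hz'
  obtain ⟨t, ht, rfl⟩ := hz'
  rw [circleMean, Real.circleAverage_def, smul_eq_mul]
  refine mul_pos (by positivity) ?_
  have hc : Continuous fun θ : ℝ => (evalAt (circleMap 0 1 θ) (invSubst f * f)).re := by
    refine Complex.continuous_re.comp (ContinuousOn.comp_continuous (continuousOn_evalAt
      (mul_mem (invSubst_mem_circleAlg hf) hf)) (continuous_circleMap 0 1) fun θ => ?_)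
    exact circleMap_mem_sphere _ zero_le_one _
  refine intervalIntegral.integral_pos Real.two_pi_pos hc.continuousOn (fun θ _ => ?_)
    ⟨t, Set.Ioc_subset_Icc_self ht, ?_⟩
  · rw [evalAt_invSubst_mul_self hf (circleMap_mem_sphere _ zero_le_one _)]
    positivity
  · rw [evalAt_invSubst_mul_self hf hz]
    positivity

theorem eq_zero_of_sum_circleMean_eq_zero {ι : Type*} [Fintype ι] {f : ι → RatFunc ℝ}
    (hf : ∀ i, f i ∈ circleAlg) (h : circleMean (∑ i, invSubst (f i) * f i) = 0) : f = 0 := by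
  rw [circleMean_sum _ fun i _ => mul_mem (invSubst_mem_circleAlg (hf i)) (hf i),
    Finset.sum_eq_zero_iff_of_nonneg fun i _ => circleMean_invSubst_mul_self_nonneg (hf i)] at h
  funext i
  by_contra h0
  exact (circleMean_invSubst_mul_self_pos (hf i) h0).ne' (h i (Finset.mem_univ i))

/-! ### Splitting into parts analytic inside and outside the disk -/

/-- A function analytic in the disk is its value at `0` plus a multiple of `X`. -/
theorem exists_eq_C_add_X_mul {f : RatFunc ℝ} (hf : f ∈ diskAlg) :
    ∃ c : ℝ, ∃ g ∈ diskAlg, f = RatFunc.C c + RatFunc.X * g := by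
  have hd : f.denom.coeff 0 ≠ 0 := by
    have := hf 0 (by simp)
    simpa [NoPoleAt, aeval_def, eval₂_at_zero] using this
  set c := f.num.coeff 0 / f.denom.coeff 0
  obtain ⟨r, hr⟩ : X ∣ f.num - C c * f.denom := by
    rw [X_dvd_iff]
    simp [c, hd]
  refine ⟨c, _, div_mem_regularOn r hf, ?_⟩
  have hd0 := RatFunc.algebraMap_ne_zero (K := ℝ) f.denom_ne_zero
  rw [mul_div_assoc', ← RatFunc.algebraMap_X, ← map_mul, ← hr, map_sub, map_mul,
    RatFunc.algebraMap_C, sub_div, mul_div_cancel_right₀ _ hd0, RatFunc.num_div_denom]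
  ring

/-- A form of Liouville's theorem. With h = f - f(0) = X g, the function h*h = X (g h*) is X times a
function analytic in the disk, so |h|² has mean zero. -/
theorem eq_C_of_mem_diskAlg {f : RatFunc ℝ} (hf : f ∈ diskAlg) (hf' : invSubst f ∈ diskAlg) :
    ∃ c : ℝ, f = RatFunc.C c := by
  obtain ⟨c, g, hg, hfg⟩ := exists_eq_C_add_X_mul hf
  refine ⟨c, ?_⟩
  set h := RatFunc.X * g with hh
  have h1 : invSubst h ∈ diskAlg := by
    have : invSubst h = invSubst f - RatFunc.C c := by rw [hfg]; simp
    rw [this]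
    exact sub_mem hf' (C_mem_regularOn _ c)
  have h2 : h ∈ circleAlg := diskAlg_le_circleAlg (mul_mem (X_mem_regularOn _) hg)
  have h3 : h = 0 := by
    by_contra h0
    refine (circleMean_invSubst_mul_self_pos h2 h0).ne' ?_
    rw [show invSubst h * h = RatFunc.X * (g * invSubst h) by rw [hh]; ring]
    exact circleMean_X_mul (mul_mem hg h1)
  rw [hfg, h3, add_zero]

/-- Two roots of a real irreducible polynomial are equal or complex conjugate. Hence each
irreducible factor lies entirely on one side of the circle. -/
theorem norm_eq_of_irreducible {q : ℝ[X]} (hq : Irreducible q) {z w : ℂ} (hz : aeval z q = 0)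
    (hw : aeval w q = 0) : ‖z‖ = ‖w‖ := by
  have h : minpoly ℝ z = minpoly ℝ w := by
    rw [← minpoly.eq_of_irreducible hq hz, ← minpoly.eq_of_irreducible hq hw]
  have : IsAlgClosure ℝ ℂ := ⟨inferInstance, inferInstance⟩
  obtain ⟨σ, hσ⟩ := (isConjRoot_iff_exists_algEquiv (K := ℝ) (L := ℂ)).1 h
  rcases Complex.real_algHom_eq_id_or_conj (σ : ℂ →ₐ[ℝ] ℂ) with h1 | h1
  · have : σ w = w := DFunLike.congr_fun h1 w
    rw [← hσ, this]
  · have : σ w = starRingEnd ℂ w := DFunLike.congr_fun h1 w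
    rw [← hσ, this, RCLike.norm_conj]

theorem exists_inner_outer_factors (q : ℝ[X]) (hq : ∀ z : ℂ, ‖z‖ = 1 → aeval z q ≠ 0) :
    ∃ p r : ℝ[X], q = p * r ∧ (∀ z : ℂ, 1 ≤ ‖z‖ → aeval z p ≠ 0) ∧
      ∀ z : ℂ, ‖z‖ ≤ 1 → aeval z r ≠ 0 := by
  induction q using UniqueFactorizationMonoid.induction_on_prime with
  | h₁ => exact absurd (by simp) (hq 1 (by simp))
  | h₂ x hx =>
    obtain ⟨c, hc, rfl⟩ := Polynomial.isUnit_iff.1 hx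
    have : c ≠ 0 := hc.ne_zero
    exact ⟨1, C c, by simp, by simp, by simp [this]⟩
  | h₃ a x ha hx ih =>
    obtain ⟨p, r, rfl, hp, hr⟩ := ih fun z hz h => hq z hz (by simp [h])
    by_cases h : ∃ z : ℂ, ‖z‖ < 1 ∧ aeval z x = 0
    · obtain ⟨z, hz, hz0⟩ := h
      refine ⟨x * p, r, by ring, fun w hw h0 => ?_, hr⟩
      rw [map_mul] at h0
      rcases mul_eq_zero.1 h0 with h0 | h0
      · rw [norm_eq_of_irreducible hx.irreducible hz0 h0] at hz
        linarith
      · exact hp w hw h0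
    · push Not at h
      refine ⟨p, x * r, by ring, hp, fun w hw h0 => ?_⟩
      rw [map_mul] at h0
      rcases mul_eq_zero.1 h0 with h0 | h0
      · rcases hw.lt_or_eq with hw | hw
        · exact h w hw h0
        · exact hq w hw (by simp [h0])
      · exact hr w hw h0

/-- Additive (Wiener–Hopf) splitting of a rational function without poles on the circle. -/
theorem exists_add_eq_of_mem_circleAlg {f : RatFunc ℝ} (hf : f ∈ circleAlg) :
    ∃ g h, invSubst g ∈ diskAlg ∧ h ∈ diskAlg ∧ f = g + RatFunc.X * h := by
  obtain ⟨p, r, hpr, hp, hr⟩ := exists_inner_outer_factors f.denom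
    fun z hz => hf z (by simpa using hz)
  have hcop : IsCoprime p r := by
    refine (Polynomial.isCoprime_iff_aeval_ne_zero_of_isAlgClosed ℝ ℂ p r).2 fun z => ?_
    rcases le_total 1 ‖z‖ with h | h
    exacts [.inl (hp z h), .inr (hr z h)]
  have hp0 : p ≠ 0 := fun h => f.denom_ne_zero (by rw [hpr, h, zero_mul])
  have hr0 : r ≠ 0 := fun h => f.denom_ne_zero (by rw [hpr, h, mul_zero])
  obtain ⟨a, b, hab⟩ := hcop
  set φ := algebraMap ℝ[X] (RatFunc ℝ)
  have hp1 : φ p ≠ 0 := RatFunc.algebraMap_ne_zero hp0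
  have hr1 : φ r ≠ 0 := RatFunc.algebraMap_ne_zero hr0
  set s := f.num * b
  -- Partial fractions: the Bezout relation separates `p` from `r`, and the remainder modulo `p`
  -- makes the fraction over `p` proper.
  have hs : φ s = φ p * φ (s / p) + φ (s % p) := by
    rw [← map_mul, ← map_add, EuclideanDomain.div_add_mod]
  have hfe : f = φ (s % p) / φ p + (φ (s / p) + φ (f.num * a) / φ r) := by
    have h1 : f = φ f.num / (φ p * φ r) := by
      rw [← map_mul, ← hpr, RatFunc.num_div_denom]
    have h2 : φ a * φ p + φ b * φ r = 1 := by rw [← map_mul, ← map_mul, ← map_add, hab, map_one]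
    have h3 : φ s = φ f.num * φ b := map_mul _ _ _
    have h4 : φ (s % p) = φ f.num * φ b - φ p * φ (s / p) := by rw [← h3, hs]; ring
    rw [h4, map_mul]
    conv_lhs => rw [h1]
    field_simp
    linear_combination (-φ f.num) * h2
  have hg : invSubst (φ (s % p) / φ p) ∈ diskAlg :=
    invSubst_div_mem_diskAlg (natDegree_le_natDegree (degree_mod_lt s hp0).le) hp
  have hh : φ (s / p) + φ (f.num * a) / φ r ∈ diskAlg :=
    add_mem (algebraMap_mem_regularOn _ _)
      (div_mem_regularOn _ fun z hz => hr z (by simpa using hz))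
  -- The constant term goes to the outer part, so that the inner part is a multiple of `X`.
  obtain ⟨c, k, hk, hck⟩ := exists_eq_C_add_X_mul hh
  refine ⟨φ (s % p) / φ p + RatFunc.C c, k, ?_, hk, ?_⟩
  · rw [map_add, invSubst_C]
    exact add_mem hg (C_mem_regularOn _ c)
  · rw [add_assoc, ← hck, ← hfe]

/-- If the Fourier coefficients of `f` with index `1, …, d` vanish, then `f` is the sum of a part
analytic outside the disk and `X ^ (d + 1)` times a part analytic in the disk. -/
theorem exists_add_eq_of_circleMean_eq_zero {f : RatFunc ℝ} (hf : f ∈ circleAlg) (d : ℕ)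
    (h : ∀ j < d, circleMean (invSubst (RatFunc.X ^ (j + 1)) * f) = 0) :
    ∃ g h, invSubst g ∈ diskAlg ∧ h ∈ diskAlg ∧ f = g + RatFunc.X ^ (d + 1) * h := by
  induction d with
  | zero => simpa using exists_add_eq_of_mem_circleAlg hf
  | succ d ih =>
    obtain ⟨g, k, hg, hk, hfgk⟩ := ih fun j hj => h j (by omega)
    obtain ⟨c, l, hl, rfl⟩ := exists_eq_C_add_X_mul hk
    have hX : (RatFunc.X : RatFunc ℝ) ≠ 0 := RatFunc.X_ne_zero
    have hgL : g ∈ circleAlg := by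
      simpa using invSubst_mem_circleAlg (diskAlg_le_circleAlg hg)
    have hXi : invSubst (RatFunc.X ^ (d + 1)) ∈ circleAlg :=
      invSubst_mem_circleAlg (pow_mem (X_mem_regularOn _) _)
    have h1 := h d (by omega)
    -- Dividing by `X ^ (d + 1)` isolates the coefficient `c`: the other two terms have mean zero,
    -- the first one after conjugation.
    have h2 : invSubst (RatFunc.X ^ (d + 1)) * f =
        invSubst (RatFunc.X ^ (d + 1)) * g + (RatFunc.C c + RatFunc.X * l) := by
      rw [hfgk, map_pow, invSubst_X, mul_add, inv_pow,
        inv_mul_cancel_left₀ (pow_ne_zero _ hX)]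
    have h3 : circleMean (invSubst (RatFunc.X ^ (d + 1)) * g) = 0 := by
      rw [← circleMean_invSubst (mul_mem hXi hgL), map_mul, invSubst_invSubst, pow_succ', mul_assoc]
      exact circleMean_X_mul (mul_mem (pow_mem (X_mem_regularOn _) _) hg)
    rw [h2, circleMean_add (mul_mem hXi hgL) (diskAlg_le_circleAlg hk), h3,
      circleMean_add (C_mem_regularOn _ c)
        (diskAlg_le_circleAlg (mul_mem (X_mem_regularOn _) hl)), circleMean_C,
      circleMean_X_mul hl, zero_add, add_zero] at h1
    refine ⟨g, l, hg, hl, ?_⟩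
    rw [hfgk, h1, map_zero]
    ring

/-! ### Transfer matrices: entries, conjugation, evaluation -/

/-- All entries of `F` lie in `A`. -/
def EntriesIn (A : Subalgebra ℝ (RatFunc ℝ)) {α β : Type*} (F : TFMatrix α β) : Prop :=
  ∀ i j, F i j ∈ A

namespace EntriesIn

variable {A B : Subalgebra ℝ (RatFunc ℝ)} {α β γ : Type*}

theorem mono (h : A ≤ B) {F : TFMatrix α β} (hF : EntriesIn A F) : EntriesIn B F :=
  fun i j => h (hF i j)

theorem mul [Fintype β] {F : TFMatrix α β} {G : TFMatrix β γ} (hF : EntriesIn A F)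
    (hG : EntriesIn A G) : EntriesIn A (F * G) :=
  fun i j => Subalgebra.sum_mem _ fun k _ => mul_mem (hF i k) (hG k j)

theorem add {F G : TFMatrix α β} (hF : EntriesIn A F) (hG : EntriesIn A G) :
    EntriesIn A (F + G) := fun i j => add_mem (hF i j) (hG i j)

theorem neg {F : TFMatrix α β} (hF : EntriesIn A F) : EntriesIn A (-F) :=
  fun i j => neg_mem (hF i j)

theorem sub {F G : TFMatrix α β} (hF : EntriesIn A F) (hG : EntriesIn A G) :
    EntriesIn A (F - G) := fun i j => sub_mem (hF i j) (hG i j)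

theorem smul {f : RatFunc ℝ} (hf : f ∈ A) {F : TFMatrix α β} (hF : EntriesIn A F) :
    EntriesIn A (f • F) := fun i j => mul_mem hf (hF i j)

theorem one [DecidableEq α] : EntriesIn A (1 : TFMatrix α α) := fun i j => by
  rw [Matrix.one_apply]
  split_ifs
  exacts [one_mem _, zero_mem _]

theorem transpose {F : TFMatrix α β} (hF : EntriesIn A F) : EntriesIn A F.transpose :=
  fun i j => hF j i

theorem map_C {S : Set ℂ} (c : Matrix α β ℝ) :
    EntriesIn (regularOn S) (c.map (RatFunc.C (K := ℝ))) := fun _ _ => C_mem_regularOn _ _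

theorem conjTF {F : TFMatrix α β} (hF : EntriesIn circleAlg F) :
    EntriesIn circleAlg (conjTF F) := fun i j => by
  change RatFunc.eval _ _ _ ∈ _
  rw [← invSubst_apply]
  exact invSubst_mem_circleAlg (hF j i)

end EntriesIn

section conj

variable {α β γ : Type*}

theorem conjTF_apply (F : TFMatrix α β) (i : β) (j : α) : conjTF F i j = invSubst (F j i) :=
  (invSubst_apply _).symm

@[simp] theorem conjTF_conjTF (F : TFMatrix α β) : conjTF (conjTF F) = F := by
  ext i j
  rw [conjTF_apply, conjTF_apply, invSubst_invSubst]

theorem conjTF_mul [Fintype β] (F : TFMatrix α β) (G : TFMatrix β γ) :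
    conjTF (F * G) = conjTF G * conjTF F := by
  ext i j
  simp only [conjTF_apply, Matrix.mul_apply, map_sum, map_mul]
  exact Finset.sum_congr rfl fun _ _ => mul_comm _ _

@[simp] theorem conjTF_one [DecidableEq α] : conjTF (1 : TFMatrix α α) = 1 := by
  ext i j
  rw [conjTF_apply, Matrix.one_apply, Matrix.one_apply]
  split_ifs <;> simp_all

theorem conjTF_add (F G : TFMatrix α β) : conjTF (F + G) = conjTF F + conjTF G := by
  ext i j; simp [conjTF_apply]

theorem conjTF_sub (F G : TFMatrix α β) : conjTF (F - G) = conjTF F - conjTF G := by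
  ext i j; simp [conjTF_apply]

theorem conjTF_smul (f : RatFunc ℝ) (F : TFMatrix α β) :
    conjTF (f • F) = invSubst f • conjTF F := by
  ext i j; simp [conjTF_apply]

theorem conjTF_map_C (c : Matrix α β ℝ) :
    conjTF (c.map (RatFunc.C (K := ℝ))) = c.transpose.map (RatFunc.C (K := ℝ)) := by
  ext i j; simp [conjTF_apply]

theorem conjTF_transpose (F : TFMatrix α β) : conjTF F.transpose = (conjTF F).transpose := by
  ext i j; simp [conjTF_apply]

theorem isRHInf_iff {F : TFMatrix α β} : IsRHInf F ↔ EntriesIn diskAlg (conjTF F) := by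
  simp only [IsRHInf, EntriesIn, conjTF_apply, isRHInf_entry_iff]
  exact forall_comm

end conj

section eval

variable {α β γ : Type*} {S : Set ℂ} {z : ℂ}

theorem evalTF_mul [Fintype β] {F : TFMatrix α β} {G : TFMatrix β γ}
    (hF : EntriesIn (regularOn S) F) (hG : EntriesIn (regularOn S) G) (hz : z ∈ S) :
    evalTF (F * G) z = evalTF F z * evalTF G z := by
  ext i j
  have h := map_sum (evalHom hz)
    (fun k => (⟨F i k * G k j, mul_mem (hF i k) (hG k j)⟩ : regularOn S)) Finset.univ
  have h2 : (∑ k, (⟨F i k * G k j, mul_mem (hF i k) (hG k j)⟩ : regularOn S)).1 =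
      (F * G) i j := by
    rw [AddSubmonoidClass.coe_finsetSum]
    rfl
  change evalAt z ((F * G) i j) = _
  rw [← h2]
  refine h.trans ?_
  rw [Matrix.mul_apply]
  exact Finset.sum_congr rfl fun k _ => evalAt_mul (hF i k z hz) (hG k j z hz)

theorem evalTF_one [DecidableEq α] : evalTF (1 : TFMatrix α α) z = 1 := by
  ext i j
  simp only [evalTF, Matrix.map_apply, Matrix.one_apply]
  split_ifs <;> simp

theorem evalTF_sub {F G : TFMatrix α β} (hF : EntriesIn (regularOn S) F)
    (hG : EntriesIn (regularOn S) G) (hz : z ∈ S) :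
    evalTF (F - G) z = evalTF F z - evalTF G z := by
  ext i j
  exact map_sub (evalHom hz) ⟨F i j, hF i j⟩ ⟨G i j, hG i j⟩

theorem evalTF_smul {f : RatFunc ℝ} (hf : f ∈ regularOn S) {F : TFMatrix α β}
    (hF : EntriesIn (regularOn S) F) (hz : z ∈ S) :
    evalTF (f • F) z = evalAt z f • evalTF F z := by
  ext i j
  exact evalAt_mul (hf z hz) (hF i j z hz)

theorem evalTF_conjTF {F : TFMatrix α β} (hF : EntriesIn circleAlg F)
    (hz : z ∈ Metric.sphere (0 : ℂ) 1) : evalTF (conjTF F) z = (evalTF F z).conjTranspose := by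
  ext i j
  change evalAt z (conjTF F i j) = starRingEnd ℂ (evalAt z (F j i))
  rw [conjTF_apply]
  exact (evalAt_invSubst (by simpa using hz) (hF j i z hz)).2

theorem EntriesIn.exists_lift {A : Subalgebra ℝ (RatFunc ℝ)} {F : TFMatrix α β}
    (hF : EntriesIn A F) : ∃ F' : Matrix α β A, F = F'.map A.val.toRingHom :=
  ⟨Matrix.of fun i j => ⟨F i j, hF i j⟩, rfl⟩

/-- Cramer's rule. Lifting `F` to the subalgebra lets evaluation, a ring homomorphism there, commute
with the determinant. -/
theorem EntriesIn.inv_of_det_ne_zero [Fintype α] [DecidableEq α] {F : TFMatrix α α}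
    (hF : EntriesIn (regularOn S) F) (hS : S.Nonempty) (h : ∀ z ∈ S, (evalTF F z).det ≠ 0) :
    F * F⁻¹ = 1 ∧ EntriesIn (regularOn S) F⁻¹ := by
  obtain ⟨F', rfl⟩ := hF.exists_lift
  set F := F'.map (regularOn S).val.toRingHom
  have hdet : F.det = (F'.det : regularOn S) :=
    ((regularOn S).val.toRingHom.map_det F').symm
  have hmem : F.det ∈ regularOn S := hdet ▸ F'.det.2
  have heval : ∀ z ∈ S, evalAt z F.det ≠ 0 := by
    intro z hz
    have h1 : evalAt z F.det = evalHom hz F'.det := by rw [hdet]; rfl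
    have h2 : evalHom hz F'.det = (evalTF F z).det := (evalHom hz).toRingHom.map_det F'
    rw [h1, h2]
    exact h z hz
  have h0 : F.det ≠ 0 := by
    intro h0
    obtain ⟨z, hz⟩ := hS
    exact heval z hz (by rw [h0]; exact RatFunc.eval_zero _ _)
  refine ⟨Matrix.mul_nonsing_inv F (isUnit_iff_ne_zero.2 h0), ?_⟩
  rw [Matrix.inv_def, Ring.inverse_eq_inv']
  refine EntriesIn.smul (inv_mem_regularOn hmem heval) ?_
  have : F.adjugate = F'.adjugate.map (regularOn S).val.toRingHom :=
    ((regularOn S).val.toRingHom.map_adjugate F').symm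
  rw [this]
  exact fun i j => (F'.adjugate i j).2

end eval

/-! ### Entrywise means of matrices -/

section mean

variable {α β γ : Type*}

theorem map_circleMean_mul_C [Fintype β] {F : TFMatrix α β} (hF : EntriesIn circleAlg F)
    (c : Matrix β γ ℝ) :
    (F * c.map (RatFunc.C (K := ℝ))).map circleMean = F.map circleMean * c := by
  ext i j
  simp only [Matrix.map_apply, Matrix.mul_apply]
  rw [circleMean_sum _ fun k _ => mul_mem (hF i k) (C_mem_regularOn _ _)]
  exact Finset.sum_congr rfl fun k _ => by
    rw [mul_comm, circleMean_C_mul _ (hF i k), mul_comm]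

theorem map_circleMean_C_mul [Fintype β] {F : TFMatrix β γ} (hF : EntriesIn circleAlg F)
    (c : Matrix α β ℝ) :
    (c.map (RatFunc.C (K := ℝ)) * F).map circleMean = c * F.map circleMean := by
  ext i j
  simp only [Matrix.map_apply, Matrix.mul_apply]
  rw [circleMean_sum _ fun k _ => mul_mem (C_mem_regularOn _ _) (hF k j)]
  exact Finset.sum_congr rfl fun k _ => circleMean_C_mul _ (hF k j)

theorem map_circleMean_add {F G : TFMatrix α β} (hF : EntriesIn circleAlg F)
    (hG : EntriesIn circleAlg G) :
    (F + G).map circleMean = F.map circleMean + G.map circleMean := by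
  ext i j
  exact circleMean_add (hF i j) (hG i j)

theorem map_circleMean_one [DecidableEq α] : (1 : TFMatrix α α).map circleMean = 1 := by
  ext i j
  rw [Matrix.map_apply, Matrix.one_apply, Matrix.one_apply]
  split_ifs
  · simpa using circleMean_C 1
  · simpa using circleMean_C 0

/-- Definiteness of the mean of `G* G`. -/
theorem eq_zero_of_circleMean_conjTF_mul_self [Fintype α] {G : TFMatrix α β}
    (hG : EntriesIn circleAlg G) (h : ∀ k, circleMean ((conjTF G * G) k k) = 0) : G = 0 := by
  ext i k
  refine congrFun (eq_zero_of_sum_circleMean_eq_zero (f := fun i => G i k) (fun i => hG i k) ?_) i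
  simpa only [Matrix.mul_apply, conjTF_apply] using h k

theorem circleMean_conjTF_mul_self_nonneg [Fintype α] {G : TFMatrix α β}
    (hG : EntriesIn circleAlg G) (k : β) : 0 ≤ circleMean ((conjTF G * G) k k) := by
  simp only [Matrix.mul_apply, conjTF_apply]
  rw [circleMean_sum _ fun i _ => mul_mem (invSubst_mem_circleAlg (hG i k)) (hG i k)]
  exact Finset.sum_nonneg fun i _ => circleMean_invSubst_mul_self_nonneg (hG i k)

end mean

/-! ### The monomials X, …, X ^ d in vector form -/

section shift

variable {α γ : Type*} [DecidableEq α] (d : ℕ)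

/-- The columns `X ^ j eᵢ` for `1 ≤ j ≤ d`. -/
def shiftBasis (d : ℕ) (α : Type*) [DecidableEq α] : TFMatrix α (Fin d × α) :=
  Matrix.of fun i k => if i = k.2 then RatFunc.X ^ (k.1.1 + 1) else 0

theorem entriesIn_shiftBasis (S : Set ℂ) : EntriesIn (regularOn S) (shiftBasis d α) := by
  intro i k
  rw [shiftBasis, Matrix.of_apply]
  split_ifs
  exacts [pow_mem (X_mem_regularOn _) _, zero_mem _]

theorem entriesIn_X_pow_smul_conjTF_shiftBasis :
    EntriesIn diskAlg ((RatFunc.X ^ d : RatFunc ℝ) • conjTF (shiftBasis d α)) := by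
  intro k i
  rw [Matrix.smul_apply, conjTF_apply, shiftBasis, Matrix.of_apply]
  split_ifs
  · have h : d = (d - (k.1.1 + 1)) + (k.1.1 + 1) := by have := k.1.2; omega
    rw [map_pow, invSubst_X, smul_eq_mul, inv_pow]
    nth_rw 1 [h]
    rw [pow_add, mul_inv_cancel_right₀ (pow_ne_zero _ RatFunc.X_ne_zero)]
    exact pow_mem (X_mem_regularOn _) _
  · simp

/-- The exponents start at 1. Hence the orthogonal polynomial below has mean `1`. -/
theorem map_circleMean_shiftBasis : (shiftBasis d α).map circleMean = 0 := by
  ext i k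
  rw [Matrix.map_apply, shiftBasis, Matrix.of_apply, Matrix.zero_apply]
  split_ifs
  · rw [pow_succ']
    exact circleMean_X_mul (pow_mem (X_mem_regularOn _) _)
  · simpa using circleMean_C 0

theorem conjTF_shiftBasis_mul_apply [Fintype α] (B : TFMatrix α γ) (k : Fin d × α) (l : γ) :
    (conjTF (shiftBasis d α) * B) k l = invSubst (RatFunc.X ^ (k.1.1 + 1)) * B k.2 l := by
  rw [Matrix.mul_apply, Finset.sum_eq_single k.2]
  · simp [conjTF_apply, shiftBasis]
  · intro i _ hi
    simp [conjTF_apply, shiftBasis, hi]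
  · simp

theorem eq_zero_of_shiftBasis_mul_eq_zero [Fintype α] {a : Matrix (Fin d × α) γ ℝ}
    (h : shiftBasis d α * a.map (RatFunc.C (K := ℝ)) = 0) : a = 0 := by
  ext ⟨j, i⟩ l
  have h1 : (shiftBasis d α * a.map (RatFunc.C (K := ℝ))) i l =
      algebraMap ℝ[X] (RatFunc ℝ) (∑ j : Fin d, monomial (j.1 + 1) (a (j, i) l)) := by
    rw [Matrix.mul_apply, Fintype.sum_prod_type, map_sum]
    refine Finset.sum_congr rfl fun j _ => ?_
    rw [Finset.sum_eq_single i]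
    · simp [shiftBasis, RatFunc.algebraMap_monomial, mul_comm]
    · intro b _ hb
      simp [shiftBasis, hb.symm]
    · simp
  rw [h, Matrix.zero_apply, eq_comm, map_eq_zero_iff _ (RatFunc.algebraMap_injective ℝ)] at h1
  have h2 := congrArg (fun p : ℝ[X] => p.coeff (j.1 + 1)) h1
  simpa [finsetSum_coeff, coeff_monomial, Fin.val_inj] using h2

end shift

section const

variable {α : Type*}

theorem exists_eq_map_C {F : TFMatrix α α} (h1 : EntriesIn diskAlg F)
    (h2 : EntriesIn diskAlg (conjTF F)) : ∃ c : Matrix α α ℝ, F = c.map (RatFunc.C (K := ℝ)) := by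
  have : ∀ i j, ∃ c : ℝ, F i j = RatFunc.C c := fun i j =>
    eq_C_of_mem_diskAlg (h1 i j) (by rw [← conjTF_apply]; exact h2 j i)
  choose c hc using this
  exact ⟨Matrix.of c, by ext i j; exact hc i j⟩

theorem map_C_mul_map_C [Fintype α] (a b : Matrix α α ℝ) :
    a.map (RatFunc.C (K := ℝ)) * b.map (RatFunc.C (K := ℝ)) =
      (a * b).map (RatFunc.C (K := ℝ)) := (Matrix.map_mul).symm

theorem map_C_one [DecidableEq α] : (1 : Matrix α α ℝ).map (RatFunc.C (K := ℝ)) = 1 :=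
  Matrix.map_one _ (map_zero _) (map_one _)

end const

/-! ### Spectral factorization of polynomial matrices -/

section factorization

variable {α β γ : Type*} [Fintype α] [Fintype β] [DecidableEq α]

theorem conjTF_eq_of_mul_eq_one {N : TFMatrix α β} {W : TFMatrix α α}
    (h : N * conjTF N * W = 1) : conjTF W = W := by
  have h1 : conjTF W * (N * conjTF N) = 1 := by
    simpa [conjTF_mul] using congrArg conjTF h
  exact left_inv_eq_right_inv h1 h

/-- Since W = W N N* W, the weighted form is a sum of squares, so positivity and definiteness of
plain means carry over. -/
theorem conjTF_mul_weight_mul {N : TFMatrix α β} {W : TFMatrix α α}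
    (h : N * conjTF N * W = 1) (U : TFMatrix α γ) :
    conjTF U * W * U = conjTF (conjTF N * W * U) * (conjTF N * W * U) := by
  have h1 := conjTF_eq_of_mul_eq_one h
  calc conjTF U * W * U = conjTF U * W * (N * conjTF N * W) * U := by rw [h, Matrix.mul_one]
    _ = _ := by simp only [conjTF_mul, conjTF_conjTF, h1, Matrix.mul_assoc]

theorem circleMean_weight_nonneg {N : TFMatrix α β} {W : TFMatrix α α}
    (hN : EntriesIn circleAlg N) (hW : EntriesIn circleAlg W) (h : N * conjTF N * W = 1)
    {U : TFMatrix α γ} (hU : EntriesIn circleAlg U) (k : γ) :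
    0 ≤ circleMean ((conjTF U * W * U) k k) := by
  rw [conjTF_mul_weight_mul h]
  exact circleMean_conjTF_mul_self_nonneg ((hN.conjTF.mul hW).mul hU) k

theorem eq_zero_of_circleMean_weight {N : TFMatrix α β} {W : TFMatrix α α}
    (hN : EntriesIn circleAlg N) (hW : EntriesIn circleAlg W) (h : N * conjTF N * W = 1)
    {U : TFMatrix α γ} (hU : EntriesIn circleAlg U)
    (h0 : ∀ k, circleMean ((conjTF U * W * U) k k) = 0) : U = 0 := by
  rw [conjTF_mul_weight_mul h] at h0
  have h1 := eq_zero_of_circleMean_conjTF_mul_self ((hN.conjTF.mul hW).mul hU) h0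
  calc U = N * (conjTF N * W * U) := by
        rw [← Matrix.mul_assoc, ← Matrix.mul_assoc, h, Matrix.one_mul]
    _ = 0 := by rw [h1, Matrix.mul_zero]

/-- The normal equations: a monic matrix polynomial of degree at most `d` orthogonal to
`X, …, X ^ d` for the weight `W`. -/
theorem exists_orthogonal_polynomial {N : TFMatrix α β} {W : TFMatrix α α}
    (hN : EntriesIn circleAlg N) (hW : EntriesIn circleAlg W) (h : N * conjTF N * W = 1) (d : ℕ) :
    ∃ c : Matrix (Fin d × α) α ℝ,
      (conjTF (shiftBasis d α) * W *
        (1 + shiftBasis d α * c.map (RatFunc.C (K := ℝ)))).map circleMean = 0 := by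
  set E := shiftBasis d α
  have hE : EntriesIn circleAlg E := entriesIn_shiftBasis d _
  have hEW : EntriesIn circleAlg (conjTF E * W) := hE.conjTF.mul hW
  have hEWE : EntriesIn circleAlg (conjTF E * W * E) := hEW.mul hE
  set Γ : Matrix (Fin d × α) (Fin d × α) ℝ := (conjTF E * W * E).map circleMean with hΓ
  -- The Gram matrix `Γ` is nonsingular: a kernel vector `a` gives a polynomial `E a` of weighted
  -- norm zero, and the monomials are independent.
  have hinj : Function.Injective Γ.mulVec := by
    refine (injective_iff_map_eq_zero (Matrix.mulVecLin Γ)).2 fun a ha => ?_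
    rw [Matrix.mulVecLin_apply] at ha
    set a' : Matrix (Fin d × α) Unit ℝ := Matrix.replicateCol Unit a with ha'
    have h1 : Γ * a' = 0 := by
      rw [ha', ← Matrix.replicateCol_mulVec, ha]
      rfl
    set U := E * a'.map (RatFunc.C (K := ℝ)) with hU
    have hUL : EntriesIn circleAlg U := hE.mul (EntriesIn.map_C _)
    have h2 : (conjTF U * W * U).map circleMean = 0 := by
      have : conjTF U * W * U = a'.transpose.map (RatFunc.C (K := ℝ)) *
          ((conjTF E * W * E) * a'.map (RatFunc.C (K := ℝ))) := by
        rw [hU, conjTF_mul, conjTF_map_C]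
        simp only [Matrix.mul_assoc]
      rw [this, map_circleMean_C_mul (hEWE.mul (EntriesIn.map_C _)), map_circleMean_mul_C hEWE,
        ← hΓ, h1, Matrix.mul_zero]
    have h3 := eq_zero_of_circleMean_weight hN hW h hUL fun k => congrFun (congrFun h2 k) k
    have h4 := eq_zero_of_shiftBasis_mul_eq_zero d h3
    funext k
    exact congrFun (congrFun h4 k) ()
  have hunit : IsUnit Γ := Matrix.mulVec_injective_iff_isUnit.1 hinj
  refine ⟨-(Γ⁻¹ * (conjTF E * W).map circleMean), ?_⟩
  rw [Matrix.mul_add, Matrix.mul_one, ← Matrix.mul_assoc,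
    map_circleMean_add hEW (hEWE.mul (EntriesIn.map_C _)), map_circleMean_mul_C hEWE, ← hΓ,
    Matrix.mul_neg, Matrix.mul_nonsing_inv_cancel_left _ _ ((Matrix.isUnit_iff_isUnit_det _).1 hunit),
    add_neg_cancel]

/-- The orthogonal polynomial of degree `d` solves the spectral factorization problem up to a
constant matrix. -/
theorem exists_weight_mul_stable {N : TFMatrix α β} {W : TFMatrix α α} {d : ℕ}
    (hN : EntriesIn diskAlg N) (hNd : EntriesIn diskAlg ((RatFunc.X ^ d : RatFunc ℝ) • conjTF N))
    (hW : EntriesIn circleAlg W) (h : N * conjTF N * W = 1) :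
    ∃ A : TFMatrix α α, EntriesIn diskAlg A ∧ EntriesIn diskAlg (conjTF (W * A)) ∧
      A.map circleMean = 1 := by
  have hNL := hN.mono diskAlg_le_circleAlg
  obtain ⟨c, hc⟩ := exists_orthogonal_polynomial hNL hW h d
  set E := shiftBasis d α
  set A := 1 + E * c.map (RatFunc.C (K := ℝ)) with hA
  have hAD : EntriesIn diskAlg A :=
    EntriesIn.one.add ((entriesIn_shiftBasis d _).mul (EntriesIn.map_C _))
  have hAd : EntriesIn diskAlg ((RatFunc.X ^ d : RatFunc ℝ) • conjTF A) := by
    rw [hA, conjTF_add, conjTF_one, conjTF_mul, conjTF_map_C, smul_add, ← Matrix.mul_smul]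
    exact (EntriesIn.smul (pow_mem (X_mem_regularOn _) _) EntriesIn.one).add
      ((EntriesIn.map_C _).mul (entriesIn_X_pow_smul_conjTF_shiftBasis d))
  set B := W * A with hB
  have hBL : EntriesIn circleAlg B := hW.mul (hAD.mono diskAlg_le_circleAlg)
  have hsplit : ∀ i l, ∃ g k, invSubst g ∈ diskAlg ∧ k ∈ diskAlg ∧
      B i l = g + RatFunc.X ^ (d + 1) * k := fun i l => by
    refine exists_add_eq_of_circleMean_eq_zero (hBL i l) d fun j hj => ?_
    rw [Matrix.mul_assoc] at hc
    have := congrFun (congrFun hc (⟨j, hj⟩, i)) l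
    rwa [Matrix.map_apply, conjTF_shiftBasis_mul_apply] at this
  choose g k hg hk hgk using hsplit
  set Bm : TFMatrix α α := Matrix.of g
  set Bp : TFMatrix α α := Matrix.of k
  have hBm : EntriesIn diskAlg (conjTF Bm) := fun i j => by
    rw [conjTF_apply]
    exact hg j i
  have hBp : EntriesIn diskAlg Bp := hk
  have hBsum : B = Bm + (RatFunc.X ^ (d + 1) : RatFunc ℝ) • Bp := by
    ext i j
    exact hgk i j
  set Z := (RatFunc.X ^ (d + 1) : RatFunc ℝ) • Bp with hZ
  have hZL : EntriesIn circleAlg Z :=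
    (EntriesIn.smul (pow_mem (X_mem_regularOn _) _) hBp).mono diskAlg_le_circleAlg
  have hΦZ : N * conjTF N * Z = A - N * conjTF N * Bm := by
    rw [eq_sub_iff_add_eq, add_comm, ← Matrix.mul_add, ← hBsum, hB, ← Matrix.mul_assoc, h,
      Matrix.one_mul]
  -- The product is (N N* Z)* Z. Of the factor `X ^ (d + 1)` in `Z`, the power `X ^ d` makes A* and
  -- N* analytic in the disk, and the remaining `X` forces mean zero.
  have hform : conjTF (conjTF N * Z) * (conjTF N * Z) = (RatFunc.X : RatFunc ℝ) •
      ((((RatFunc.X ^ d : RatFunc ℝ) • conjTF A) -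
        conjTF Bm * (N * ((RatFunc.X ^ d : RatFunc ℝ) • conjTF N))) * Bp) := by
    calc conjTF (conjTF N * Z) * (conjTF N * Z) = conjTF (N * conjTF N * Z) * Z := by
          simp only [conjTF_mul, conjTF_conjTF, Matrix.mul_assoc]
      _ = _ := by
          rw [hΦZ, hZ, conjTF_sub, conjTF_mul, conjTF_mul, conjTF_conjTF, Matrix.mul_smul,
            Matrix.mul_smul, Matrix.mul_smul, ← smul_sub, Matrix.smul_mul, smul_smul, ← pow_succ']
  have hG : conjTF N * Z = 0 := by
    refine eq_zero_of_circleMean_conjTF_mul_self (hNL.conjTF.mul hZL) fun l => ?_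
    rw [hform]
    exact circleMean_X_mul (((hAd.sub (hBm.mul (hN.mul hNd))).mul hBp) l l)
  have hWΦ : W * (N * conjTF N) = 1 := mul_eq_one_comm.1 h
  have hZ0 : Z = 0 := by
    rw [← Matrix.one_mul Z, ← hWΦ, Matrix.mul_assoc, Matrix.mul_assoc, hG, Matrix.mul_zero,
      Matrix.mul_zero]
  refine ⟨A, hAD, ?_, ?_⟩
  · rw [← hB, hBsum, hZ0, add_zero]
    exact hBm
  · have hEL : EntriesIn circleAlg E := entriesIn_shiftBasis d _
    rw [hA, map_circleMean_add EntriesIn.one (hEL.mul (EntriesIn.map_C _)),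
      map_circleMean_mul_C hEL, map_circleMean_shiftBasis, map_circleMean_one, Matrix.zero_mul,
      add_zero]

open scoped MatrixOrder Matrix.Norms.L2Operator in
theorem exists_isUnit_transpose_mul_self {c : Matrix α α ℝ} (hc : c.PosDef) :
    ∃ L : Matrix α α ℝ, c = L.transpose * L ∧ IsUnit L := by
  obtain ⟨L, hL⟩ := CStarAlgebra.nonneg_iff_eq_star_mul_self.1
    (Matrix.nonneg_iff_posSemidef.2 hc.posSemidef)
  rw [Matrix.star_eq_conjTranspose, Matrix.conjTranspose_eq_transpose_of_trivial] at hL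
  refine ⟨L, hL, (Matrix.isUnit_iff_isUnit_det _).2 ?_⟩
  have := (Matrix.isUnit_iff_isUnit_det _).1 hc.isUnit
  rw [hL, Matrix.det_mul] at this
  exact isUnit_of_mul_isUnit_right this

/-- Matrix Fejér–Riesz factorization. -/
theorem exists_spectral_factor_of_degree_le {N : TFMatrix α β} {W : TFMatrix α α} {d : ℕ}
    (hN : EntriesIn diskAlg N) (hNd : EntriesIn diskAlg ((RatFunc.X ^ d : RatFunc ℝ) • conjTF N))
    (hW : EntriesIn circleAlg W) (h : N * conjTF N * W = 1) :
    ∃ V V' : TFMatrix α α, EntriesIn diskAlg V ∧ EntriesIn diskAlg V' ∧ V * V' = 1 ∧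
      N * conjTF N = V * conjTF V := by
  obtain ⟨A, hA, hB, hmean⟩ := exists_weight_mul_stable hN hNd hW h
  have hNL := hN.mono diskAlg_le_circleAlg
  have hAL := hA.mono diskAlg_le_circleAlg
  have hWs := conjTF_eq_of_mul_eq_one h
  have hB' : conjTF (W * A) = conjTF A * W := by rw [conjTF_mul, hWs]
  rw [hB'] at hB
  have hCs : conjTF (conjTF A * W * A) = conjTF A * W * A := by
    simp only [conjTF_mul, conjTF_conjTF, hWs, Matrix.mul_assoc]
  have hCD : EntriesIn diskAlg (conjTF A * W * A) := hB.mul hA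
  -- A*W A = (W A)* A is analytic in the disk and equal to its own conjugate.
  obtain ⟨c, hc⟩ := exists_eq_map_C hCD (hCs.symm ▸ hCD)
  obtain ⟨L, hL, hLu⟩ := exists_isUnit_transpose_mul_self (c := c) (by
    refine Matrix.PosDef.of_dotProduct_mulVec_pos ?_ fun v hv => ?_
    · ext i j
      have := congrFun (congrFun hCs i) j
      rw [hc, conjTF_map_C] at this
      exact RatFunc.C_injective this
    · set v' : Matrix α Unit ℝ := Matrix.replicateCol Unit v with hv'
      have hU : EntriesIn circleAlg (A * v'.map (RatFunc.C (K := ℝ))) :=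
        hAL.mul (EntriesIn.map_C _)
      have hform : conjTF (A * v'.map (RatFunc.C (K := ℝ))) * W *
          (A * v'.map (RatFunc.C (K := ℝ))) =
            (v'.transpose * (c * v')).map (RatFunc.C (K := ℝ)) := by
        rw [Matrix.map_mul, Matrix.map_mul, ← hc, conjTF_mul, conjTF_map_C]
        simp only [Matrix.mul_assoc]
      have hval : circleMean ((conjTF (A * v'.map (RatFunc.C (K := ℝ))) * W *
          (A * v'.map (RatFunc.C (K := ℝ)))) () ()) = star v ⬝ᵥ c.mulVec v := by
        rw [hform, Matrix.map_apply, circleMean_C]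
        rfl
      rw [← hval]
      -- If the form vanishes then A v = 0, and taking means gives v = 0 because `A` has mean `1`.
      refine lt_of_le_of_ne (circleMean_weight_nonneg hNL hW h hU _) fun h0 => hv ?_
      have h1 := eq_zero_of_circleMean_weight hNL hW h hU fun _ => h0.symm
      have h2 := map_circleMean_mul_C hAL v'
      rw [h1, hmean, Matrix.one_mul] at h2
      funext i
      have h3 := congrFun (congrFun h2 i) ()
      rw [Matrix.map_apply, Matrix.zero_apply] at h3
      rw [Pi.zero_apply, ← circleMean_C 0, map_zero, h3]
      rfl)
  have hLd : IsUnit L.det := (Matrix.isUnit_iff_isUnit_det _).1 hLu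
  have hLt : IsUnit L.transpose.det := by rwa [Matrix.det_transpose]
  have hci : c⁻¹ = L⁻¹ * L.transpose⁻¹ := by rw [hL, Matrix.mul_inv_rev]
  have hcu : IsUnit c.det := by rw [hL, Matrix.det_mul]; exact hLt.mul hLd
  have hleft : c⁻¹.map (RatFunc.C (K := ℝ)) * (conjTF A * W) * A = 1 := by
    rw [Matrix.mul_assoc, hc, map_C_mul_map_C, Matrix.nonsing_inv_mul _ hcu, map_C_one]
  have hright := mul_eq_one_comm.1 hleft
  have hV : A * L⁻¹.map (RatFunc.C (K := ℝ)) * conjTF (A * L⁻¹.map (RatFunc.C (K := ℝ))) =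
      A * (c⁻¹.map (RatFunc.C (K := ℝ)) * conjTF A) := by
    rw [conjTF_mul, conjTF_map_C, hci, ← map_C_mul_map_C, Matrix.transpose_nonsing_inv]
    simp only [Matrix.mul_assoc]
  -- Since c⁻¹A*W inverts A, the inverse of A L⁻¹ is L c⁻¹A*W, analytic because A*W = (W A)*.
  refine ⟨A * L⁻¹.map (RatFunc.C (K := ℝ)),
    L.map (RatFunc.C (K := ℝ)) * (c⁻¹.map (RatFunc.C (K := ℝ)) * (conjTF A * W)),
    hA.mul (EntriesIn.map_C _), (EntriesIn.map_C _).mul ((EntriesIn.map_C _).mul hB), ?_, ?_⟩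
  · calc _ = A * ((L⁻¹.map (RatFunc.C (K := ℝ)) * L.map (RatFunc.C (K := ℝ))) *
          (c⁻¹.map (RatFunc.C (K := ℝ)) * (conjTF A * W))) := by simp only [Matrix.mul_assoc]
      _ = 1 := by
        rw [map_C_mul_map_C, Matrix.nonsing_inv_mul _ hLd, map_C_one, Matrix.one_mul, hright]
  · rw [hV]
    have hWΦ : W * (N * conjTF N) = 1 := mul_eq_one_comm.1 h
    calc N * conjTF N = A * (c⁻¹.map (RatFunc.C (K := ℝ)) * (conjTF A * W)) * (N * conjTF N) := by
          rw [hright, Matrix.one_mul]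
      _ = A * (c⁻¹.map (RatFunc.C (K := ℝ)) * (conjTF A * (W * (N * conjTF N)))) := by
          simp only [Matrix.mul_assoc]
      _ = _ := by rw [hWΦ, Matrix.mul_one]

end factorization

/-! ### Spectral factorization of rational matrices -/

section factorization

variable {α β γ : Type*} [Fintype α]

theorem exists_common_denominator [Fintype β] {F : TFMatrix α β} (hF : EntriesIn diskAlg F) :
    ∃ q : ℝ[X], (∀ z ∈ Metric.closedBall (0 : ℂ) 1, aeval z q ≠ 0) ∧
      ∀ i j, ∃ p : ℝ[X], algebraMap ℝ[X] (RatFunc ℝ) q * F i j = algebraMap ℝ[X] (RatFunc ℝ) p := by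
  refine ⟨∏ k : α × β, (F k.1 k.2).denom, fun z hz => ?_, fun i j => ?_⟩
  · rw [map_prod]
    exact Finset.prod_ne_zero_iff.2 fun k _ => hF k.1 k.2 z hz
  · obtain ⟨r, hr⟩ := Finset.dvd_prod_of_mem (fun k : α × β => (F k.1 k.2).denom)
      (Finset.mem_univ (i, j))
    refine ⟨r * (F i j).num, ?_⟩
    have hd := RatFunc.algebraMap_ne_zero (K := ℝ) (F i j).denom_ne_zero
    rw [hr, map_mul, map_mul]
    nth_rw 2 [← RatFunc.num_div_denom (F i j)]
    field_simp

/-- A right inverse without poles on the circle keeps the rows of N(z) independent, so N(z)N(z)ᴴ is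
positive definite. -/
theorem det_evalTF_ne_zero [Fintype β] [DecidableEq α]
    {N : TFMatrix α β} {S : TFMatrix β α} (hN : EntriesIn circleAlg N)
    (hS : EntriesIn circleAlg S) (h : N * S = 1) {z : ℂ} (hz : z ∈ Metric.sphere (0 : ℂ) 1) :
    (evalTF (N * conjTF N) z).det ≠ 0 := by
  rw [evalTF_mul hN hN.conjTF hz, evalTF_conjTF hN hz]
  have h1 : evalTF N z * evalTF S z = 1 := by rw [← evalTF_mul hN hS hz, h, evalTF_one]
  open scoped ComplexOrder in
  refine (Matrix.PosDef.det_pos (Matrix.PosDef.mul_conjTranspose_self _ fun v w hvw => ?_)).ne'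
  have h2 := congrArg (fun x => Matrix.vecMul x (evalTF S z)) hvw
  simpa only [Matrix.vecMul_vecMul, h1, Matrix.vecMul_one] using h2

/-- Spectral factorization over the functions analytic in the disk. -/
theorem exists_spectral_factor [Fintype β] [DecidableEq α]
    {K : TFMatrix α β} {S : TFMatrix β α} (hK : EntriesIn diskAlg K)
    (hS : EntriesIn circleAlg S) (h : K * S = 1) :
    ∃ V V' : TFMatrix α α, EntriesIn diskAlg V ∧ EntriesIn diskAlg V' ∧ V * V' = 1 ∧
      K * conjTF K = V * conjTF V := by
  obtain ⟨q, hq, hp⟩ := exists_common_denominator hK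
  choose p hp using hp
  set u := algebraMap ℝ[X] (RatFunc ℝ) q
  have hu0 : u ≠ 0 := RatFunc.algebraMap_ne_zero fun h => hq 0 (by simp) (by simp [h])
  have huD : u ∈ diskAlg := algebraMap_mem_regularOn _ _
  have huiD : u⁻¹ ∈ diskAlg := by
    simpa using div_mem_regularOn (S := Metric.closedBall 0 1) 1 hq
  have hND : EntriesIn diskAlg (u • K) := EntriesIn.smul huD hK
  have hS' : EntriesIn circleAlg (u⁻¹ • S) := EntriesIn.smul (diskAlg_le_circleAlg huiD) hS
  have hNS : (u • K) * (u⁻¹ • S) = 1 := by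
    rw [Matrix.smul_mul, Matrix.mul_smul, smul_smul, mul_inv_cancel₀ hu0, one_smul, h]
  -- With `d` bounding the degrees of the polynomial matrix `u • K`, the entries of `X ^ d` times
  -- its conjugate are reflected polynomials.
  set d := Finset.univ.sup fun k : α × β => (p k.1 k.2).natDegree
  have hNd : EntriesIn diskAlg ((RatFunc.X ^ d : RatFunc ℝ) • conjTF (u • K)) := by
    intro j i
    have hle : (p i j).natDegree ≤ d :=
      Finset.le_sup (f := fun k : α × β => (p k.1 k.2).natDegree) (Finset.mem_univ (i, j))
    rw [Matrix.smul_apply, conjTF_apply, Matrix.smul_apply, smul_eq_mul, smul_eq_mul, hp,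
      invSubst_algebraMap, ← aeval_reflect hle RatFunc.X_ne_zero,
      RatFunc.aeval_X_left_eq_algebraMap]
    exact algebraMap_mem_regularOn _ _
  have hNL := hND.mono diskAlg_le_circleAlg
  obtain ⟨hW, hWL⟩ := (hNL.mul hNL.conjTF).inv_of_det_ne_zero ⟨1, by simp⟩
    fun z hz => det_evalTF_ne_zero hNL hS' hNS hz
  obtain ⟨V, V', hV, hV', hVV', hfac⟩ := exists_spectral_factor_of_degree_le hND hNd hWL hW
  refine ⟨u⁻¹ • V, u • V', EntriesIn.smul huiD hV, EntriesIn.smul huD hV', ?_, ?_⟩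
  · rw [Matrix.smul_mul, Matrix.mul_smul, smul_smul, inv_mul_cancel₀ hu0, one_smul, hVV']
  · have h1 : K = u⁻¹ • (u • K) := by rw [smul_smul, inv_mul_cancel₀ hu0, one_smul]
    rw [h1, conjTF_smul, Matrix.smul_mul, Matrix.mul_smul, hfac, conjTF_smul, Matrix.smul_mul,
      Matrix.mul_smul]

theorem IsRHInf.mul {F : TFMatrix γ α} {G : TFMatrix α β} (hF : IsRHInf F) (hG : IsRHInf G) :
    IsRHInf (F * G) := by
  rw [isRHInf_iff, conjTF_mul]
  exact (isRHInf_iff.1 hG).mul (isRHInf_iff.1 hF)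

/-- Spectral factorization over `RH∞`. -/
theorem exists_isRHInfUnit_spectral_factor [Fintype β] [DecidableEq α]
    {K : TFMatrix α β} {S : TFMatrix β α} (hK : IsRHInf K)
    (hS : IsRHInf S) (h : K * S = 1) :
    ∃ V, IsRHInfUnit V ∧ K * conjTF K = V * conjTF V := by
  rw [isRHInf_iff] at hK hS
  -- The matrix factored here is K(z⁻¹), the transpose of K*, which is analytic in the disk.
  obtain ⟨V, V', hV, hV', hVV', hfac⟩ := exists_spectral_factor hK.transpose
    (hS.transpose.mono diskAlg_le_circleAlg)
    (by rw [← Matrix.transpose_mul, ← conjTF_mul, h, conjTF_one, Matrix.transpose_one])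
  have hmem : ∀ {U : TFMatrix α α}, EntriesIn diskAlg U → IsRHInf (conjTF U).transpose := by
    intro U hU
    rw [isRHInf_iff, conjTF_transpose, conjTF_conjTF]
    exact hU.transpose
  have h1 : (conjTF V).transpose * (conjTF V').transpose = 1 := by
    rw [← Matrix.transpose_mul, ← conjTF_mul, hVV', conjTF_one, Matrix.transpose_one]
  refine ⟨(conjTF V).transpose, ⟨hmem hV, _, hmem hV', h1, mul_eq_one_comm.1 h1⟩, ?_⟩
  have h2 := congrArg (fun F => (conjTF F).transpose) hfac
  simpa only [conjTF_mul, conjTF_conjTF, conjTF_transpose, Matrix.transpose_mul,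
    Matrix.transpose_transpose] using h2

end factorization

/-! ### The supremum norm and proper approximation -/

section norm

open scoped Matrix.Norms.L2Operator

variable {α β : Type*}

theorem IsRHInf.entriesIn_circleAlg {F : TFMatrix α β} (hF : IsRHInf F) :
    EntriesIn circleAlg F := fun i j z hz => (hF i j).2 z (by simp_all)

theorem bddAbove_norm_evalTF [Fintype α] [Fintype β] [DecidableEq β]
    {F : TFMatrix α β} (hF : EntriesIn circleAlg F) :
    BddAbove (Set.range fun z : Metric.sphere (0 : ℂ) 1 => ‖evalTF F z‖) := by
  have hc : Continuous fun z : Metric.sphere (0 : ℂ) 1 => evalTF F z :=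
    continuous_matrix fun i j => (continuousOn_evalAt (hF i j)).domRestrict
  exact (isCompact_range (continuous_norm.comp hc)).bddAbove

theorem norm_evalTF_le_hInfNorm [Fintype α] [Fintype β] [DecidableEq β]
    {F : TFMatrix α β} (hF : EntriesIn circleAlg F) {z : ℂ}
    (hz : z ∈ Metric.sphere (0 : ℂ) 1) : ‖evalTF F z‖ ≤ hInfNorm F :=
  le_ciSup (bddAbove_norm_evalTF hF) ⟨z, hz⟩

theorem hInfNorm_le [Fintype α] [Fintype β] [DecidableEq β] {F : TFMatrix α β} {c : ℝ}
    (h : ∀ z ∈ Metric.sphere (0 : ℂ) 1, ‖evalTF F z‖ ≤ c) : hInfNorm F ≤ c := by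
  have : Nonempty (Metric.sphere (0 : ℂ) 1) := ⟨⟨1, by simp⟩⟩
  exact ciSup_le fun z => h z z.2

theorem hInfNorm_nonneg [Fintype α] [Fintype β] [DecidableEq β]
    (F : TFMatrix α β) : 0 ≤ hInfNorm F :=
  Real.iSup_nonneg fun _ => norm_nonneg _

/-- The C*-identity. Only an inequality is available, since the identity matrix of size zero has
norm 0. -/
theorem l2_opNorm_le_one_of_conjTranspose_mul_self [Fintype α] [Fintype β] [DecidableEq β]
    {A : Matrix α β ℂ}
    (h : A.conjTranspose * A = 1) : ‖A‖ ≤ 1 := by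
  have h1 := Matrix.l2_opNorm_conjTranspose_mul_self A
  have h2 : ‖(1 : Matrix β β ℂ)‖ ≤ 1 := by
    rw [← Matrix.diagonal_one, Matrix.l2_opNorm_diagonal]
    exact (pi_norm_le_iff_of_nonneg zero_le_one).2 fun i => by simp
  rw [h] at h1
  nlinarith [norm_nonneg A]

/-- A polynomial of degree at least `n` that is uniformly close to `1` on the circle. -/
theorem exists_polynomial_near_one (n : ℕ) {ε : ℝ} (hε : 0 < ε) :
    ∃ q : ℝ[X], n ≤ q.natDegree ∧ ∀ z : ℂ, ‖z‖ = 1 →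
      aeval z q ≠ 0 ∧ ‖1 - (aeval z q)⁻¹‖ ≤ ε := by
  -- The polynomial will be (1 + tX) ^ n with small t > 0; this quotient bounds its error on the
  -- circle.
  have hcont : ContinuousAt (fun t : ℝ => ((1 + t) ^ n - 1) / (1 - t) ^ n) 0 :=
    ContinuousAt.div (by fun_prop) (by fun_prop) (by simp)
  have h1 : ∀ᶠ t in nhdsWithin (0 : ℝ) (Set.Ioi 0), ((1 + t) ^ n - 1) / (1 - t) ^ n < ε := by
    refine (hcont.tendsto.eventually (gt_mem_nhds ?_)).filter_mono nhdsWithin_le_nhds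
    simpa using hε
  obtain ⟨t, ht, ht0, ht1⟩ := (h1.and (Ioo_mem_nhdsGT (zero_lt_one' ℝ))).exists
  refine ⟨(C t * X + 1) ^ n, ?_, fun z hz => ?_⟩
  · rw [natDegree_pow, ← C_1, natDegree_linear ht0.ne', mul_one]
  · have hval : aeval z ((C t * X + 1 : ℝ[X]) ^ n) = (1 + t * z) ^ n := by simp [add_comm]
    set x : ℂ := 1 + t * z
    have hxt : ‖(t : ℂ) * z‖ = t := by simp [hz, abs_of_pos ht0]
    have hx1 : ‖x‖ ≤ 1 + t := (norm_add_le _ _).trans (by rw [hxt, norm_one])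
    have hx2 : 1 - t ≤ ‖x‖ := by
      have := norm_sub_norm_le (1 : ℂ) (-(t * z))
      rwa [norm_neg, hxt, norm_one, sub_neg_eq_add] at this
    have hpow : ∀ k : ℕ, ‖x ^ k - 1‖ ≤ (1 + t) ^ k - 1 := by
      intro k
      induction k with
      | zero => simp
      | succ k ih =>
        have hk : ‖x ^ k‖ ≤ (1 + t) ^ k := by
          rw [norm_pow]; exact pow_le_pow_left₀ (norm_nonneg _) hx1 k
        calc ‖x ^ (k + 1) - 1‖ = ‖x ^ k * (t * z) + (x ^ k - 1)‖ := by
              congr 1; simp only [x]; ring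
          _ ≤ ‖x ^ k‖ * t + ‖x ^ k - 1‖ := (norm_add_le _ _).trans (by rw [norm_mul, hxt])
          _ ≤ (1 + t) ^ k * t + ((1 + t) ^ k - 1) := by gcongr
          _ = _ := by ring
    have hpos : 0 < (1 - t) ^ n := pow_pos (by linarith) n
    have hge : (1 - t) ^ n ≤ ‖x ^ n‖ := by
      rw [norm_pow]; exact pow_le_pow_left₀ (by linarith) hx2 n
    have hx0 : x ^ n ≠ 0 := norm_pos_iff.1 (hpos.trans_le hge)
    rw [hval]
    refine ⟨hx0, le_trans ?_ ht.le⟩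
    rw [show 1 - (x ^ n)⁻¹ = (x ^ n - 1) / x ^ n by field_simp, norm_div]
    exact div_le_div₀ ((norm_nonneg _).trans (hpow n)) (hpow n) hpos hge

/-- A transfer matrix without poles on the circle becomes proper after multiplication with a scalar
function close to `1` on the circle. -/
theorem exists_isRLInf_smul [Fintype α] [Fintype β]
    {F : TFMatrix α β} (hF : EntriesIn circleAlg F) {ε : ℝ} (hε : 0 < ε) :
    ∃ f ∈ circleAlg, IsRLInf (f • F) ∧
      ∀ z ∈ Metric.sphere (0 : ℂ) 1, ‖1 - evalAt z f‖ ≤ ε := by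
  -- A divisor of degree at least every numerator degree makes all entries proper.
  set n := Finset.univ.sup fun k : α × β => (F k.1 k.2).num.natDegree
  obtain ⟨q, hqn, hq⟩ := exists_polynomial_near_one n hε
  set φ := algebraMap ℝ[X] (RatFunc ℝ)
  have hf : φ 1 / φ q ∈ circleAlg := div_mem_regularOn _ fun z hz => (hq z (by simpa using hz)).1
  have hq0 : q ≠ 0 := by
    rintro rfl
    exact (hq 1 (by simp)).1 (by simp)
  refine ⟨φ 1 / φ q, hf, fun i j => ⟨?_, fun z hz => ?_⟩, fun z hz => ?_⟩
  · have h1 : (φ 1 / φ q) * F i j = φ (F i j).num / φ ((F i j).denom * q) := by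
      nth_rw 1 [← RatFunc.num_div_denom (F i j)]
      rw [map_one, map_mul, div_mul_div_comm, one_mul, mul_comm]
    have hle : (F i j).num.natDegree ≤ n :=
      Finset.le_sup (f := fun k : α × β => (F k.1 k.2).num.natDegree) (Finset.mem_univ (i, j))
    rw [Matrix.smul_apply, smul_eq_mul, h1]
    refine isProperTF_div (mul_ne_zero (F i j).denom_ne_zero hq0) ?_
    rw [natDegree_mul (F i j).denom_ne_zero hq0]
    omega
  · exact EntriesIn.smul hf hF i j z (by simpa using hz)
  · have h := hq z (by simpa using hz)
    rw [evalAt_div h.1, map_one, one_div]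
    exact h.2

end norm

/-! ### The gap as a norm -/

section gap

open scoped Matrix.Norms.L2Operator

variable {p m : ℕ}

theorem gapL2_eq_hInfNorm {J₁ J₂ : TFMatrix (Fin p ⊕ Fin m) (Fin p)}
    {P₀ : TFMatrix (Fin m) (Fin p ⊕ Fin m)} (h₁ : EntriesIn circleAlg J₁)
    (h₂ : EntriesIn circleAlg J₂) (h₀ : EntriesIn circleAlg P₀) (hJ : conjTF J₂ * J₂ = 1)
    (hP : P₀ * conjTF P₀ = 1) (hPJ : P₀ * J₂ = 0) :
    gapL2 J₁ J₂ = hInfNorm (P₀ * J₁) := by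
  have hcompl : J₂ * conjTF J₂ + conjTF P₀ * P₀ = 1 := by
    have hJP : conjTF J₂ * conjTF P₀ = 0 := by
      rw [← conjTF_mul, hPJ]
      ext i j
      simp [conjTF_apply]
    -- Both factors are square of size p + m, so this left inverse is also a right inverse, which is
    -- the claim.
    have h : Matrix.fromRows (conjTF J₂) P₀ * Matrix.fromCols J₂ (conjTF P₀) = 1 := by
      rw [Matrix.fromRows_mul_fromCols, hJ, hP, hPJ, hJP, Matrix.fromBlocks_one]
    rw [← Matrix.fromCols_mul_fromRows]
    exact mul_eq_one_comm.1 h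
  have hnormP : ∀ z ∈ Metric.sphere (0 : ℂ) 1, ‖evalTF (conjTF P₀) z‖ ≤ 1 := fun z hz => by
    refine l2_opNorm_le_one_of_conjTranspose_mul_self ?_
    rw [← evalTF_conjTF h₀.conjTF hz, conjTF_conjTF, ← evalTF_mul h₀ h₀.conjTF hz, hP, evalTF_one]
  have hnormP' : ∀ z ∈ Metric.sphere (0 : ℂ) 1, ‖evalTF P₀ z‖ ≤ 1 := fun z hz => by
    rw [← Matrix.l2_opNorm_conjTranspose, ← evalTF_conjTF h₀ hz]
    exact hnormP z hz
  have hzero : IsRLInf (0 : TFMatrix (Fin p) (Fin p)) := fun i j => by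
    simp [IsProperTF, NoPoleAt]
  have : Nonempty {Q : TFMatrix (Fin p) (Fin p) // IsRLInf Q} := ⟨⟨0, hzero⟩⟩
  refine le_antisymm (le_of_forall_pos_le_add fun ε hε => ?_) (le_ciInf fun Q => ?_)
  -- The pointwise optimal `Q`, possibly improper, hence replaced by `f • Q₀`.
  · set Q₀ := conjTF J₂ * J₁
    have hQ₀ : EntriesIn circleAlg Q₀ := h₂.conjTF.mul h₁
    set c := hInfNorm (J₂ * Q₀)
    have hc : 0 ≤ c := hInfNorm_nonneg _
    -- The error is at most ε c / (c + 1); the added 1 covers c = 0.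
    obtain ⟨f, hf, hfQ, hfε⟩ := exists_isRLInf_smul hQ₀ (div_pos hε (by linarith : 0 < c + 1))
    refine (ciInf_le ⟨0, ?_⟩ (⟨f • Q₀, hfQ⟩ : {Q : TFMatrix (Fin p) (Fin p) // IsRLInf Q})).trans
      (hInfNorm_le fun z hz => ?_)
    · rintro _ ⟨Q, rfl⟩
      exact hInfNorm_nonneg _
    · have hsplit : J₁ - J₂ * (f • Q₀) =
          conjTF P₀ * (P₀ * J₁) - (f - 1) • (J₂ * Q₀) := by
        have h : J₁ = conjTF P₀ * (P₀ * J₁) + J₂ * Q₀ := by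
          rw [← Matrix.mul_assoc, ← Matrix.mul_assoc, ← Matrix.add_mul, add_comm, hcompl,
            Matrix.one_mul]
        rw [sub_smul, one_smul, Matrix.mul_smul]
        nth_rw 1 [h]
        abel
      have hf1 : f - 1 ∈ circleAlg := sub_mem hf (one_mem _)
      have h3 : EntriesIn circleAlg (P₀ * J₁) := h₀.mul h₁
      have h4 : EntriesIn circleAlg (J₂ * Q₀) := h₂.mul hQ₀
      have hval : evalAt z (f - 1) = evalAt z f - 1 := by
        have := map_sub (evalHom hz) ⟨f, hf⟩ 1
        rw [map_one] at this
        exact this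
      simp only
      rw [hsplit, evalTF_sub (h₀.conjTF.mul h3) (EntriesIn.smul hf1 h4) hz,
        evalTF_mul h₀.conjTF h3 hz, evalTF_smul hf1 h4 hz]
      refine (norm_sub_le _ _).trans (add_le_add ?_ ?_)
      · refine (Matrix.l2_opNorm_mul _ _).trans ?_
        calc _ ≤ 1 * hInfNorm (P₀ * J₁) := mul_le_mul (hnormP z hz)
              (norm_evalTF_le_hInfNorm h3 hz) (norm_nonneg _) zero_le_one
          _ = _ := one_mul _
      · rw [norm_smul, hval, norm_sub_rev]
        calc _ ≤ ε / (c + 1) * c := mul_le_mul (hfε z hz) (norm_evalTF_le_hInfNorm h4 hz)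
              (norm_nonneg _) (by positivity)
          _ ≤ ε / (c + 1) * (c + 1) := by gcongr; linarith
          _ = ε := by field_simp
  · have hQ : EntriesIn circleAlg Q.1 := fun i j z hz => (Q.2 i j).2 z (by simpa using hz)
    refine hInfNorm_le fun z hz => ?_
    have hdiff : EntriesIn circleAlg (J₁ - J₂ * Q.1) := h₁.sub (h₂.mul hQ)
    have heq : P₀ * J₁ = P₀ * (J₁ - J₂ * Q.1) := by
      rw [Matrix.mul_sub, ← Matrix.mul_assoc, hPJ, Matrix.zero_mul, sub_zero]
    rw [heq, evalTF_mul h₀ hdiff hz]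
    refine (Matrix.l2_opNorm_mul _ _).trans ?_
    calc _ ≤ 1 * hInfNorm (J₁ - J₂ * Q.1) := mul_le_mul (hnormP' z hz)
          (norm_evalTF_le_hInfNorm hdiff hz) (norm_nonneg _) zero_le_one
      _ = _ := one_mul _

end gap

/-! ### Closure properties of RH∞ -/

section stable

variable {α β γ : Type*}

theorem IsRHInf.add {F G : TFMatrix α β} (hF : IsRHInf F) (hG : IsRHInf G) : IsRHInf (F + G) := by
  rw [isRHInf_iff, conjTF_add]
  exact (isRHInf_iff.1 hF).add (isRHInf_iff.1 hG)

theorem IsRHInf.sub {F G : TFMatrix α β} (hF : IsRHInf F) (hG : IsRHInf G) : IsRHInf (F - G) := by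
  rw [isRHInf_iff, conjTF_sub]
  exact (isRHInf_iff.1 hF).sub (isRHInf_iff.1 hG)

theorem IsRHInf.neg {F : TFMatrix α β} (hF : IsRHInf F) : IsRHInf (-F) := by
  have h : conjTF (-F) = -conjTF F := by ext i j; simp [conjTF_apply]
  rw [isRHInf_iff, h]
  exact (isRHInf_iff.1 hF).neg

theorem IsRHInf.transpose {F : TFMatrix α β} (hF : IsRHInf F) : IsRHInf F.transpose :=
  fun i j => hF j i

theorem IsRHInf.fromRows {F : TFMatrix α γ} {G : TFMatrix β γ} (hF : IsRHInf F) (hG : IsRHInf G) :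
    IsRHInf (Matrix.fromRows F G) := fun i j => by
  rcases i with i | i
  exacts [hF i j, hG i j]

theorem IsRHInf.fromCols {F : TFMatrix γ α} {G : TFMatrix γ β} (hF : IsRHInf F) (hG : IsRHInf G) :
    IsRHInf (Matrix.fromCols F G) := fun i j => by
  rcases j with j | j
  exacts [hF i j, hG i j]

end stable

/-! ### Normalizing filters -/

section normalization

variable {p m : ℕ}

/-- Factoring for Jᵀ and transposing gives J*J = U*U with U a unit, and Θ = U⁻¹. -/
theorem exists_unit_prefilter {J : TFMatrix (Fin p ⊕ Fin m) (Fin p)}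
    {L : TFMatrix (Fin p) (Fin p ⊕ Fin m)} (hJ : IsRHInf J) (hL : IsRHInf L) (h : L * J = 1) :
    ∃ Θ, IsRHInfUnit Θ ∧ IsNormalizingPrefilter J Θ := by
  obtain ⟨V, ⟨hV, H, hH, hVH, hHV⟩, hfac⟩ := exists_isRHInfUnit_spectral_factor hJ.transpose
    hL.transpose (by rw [← Matrix.transpose_mul, h, Matrix.transpose_one])
  have h1 : V.transpose * H.transpose = 1 := by
    rw [← Matrix.transpose_mul, hHV, Matrix.transpose_one]
  have h2 : conjTF J * J = conjTF V.transpose * V.transpose := by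
    have := congrArg Matrix.transpose hfac
    simpa only [Matrix.transpose_mul, conjTF_transpose, Matrix.transpose_transpose] using this
  refine ⟨H.transpose, ⟨hH.transpose, V.transpose, hV.transpose, mul_eq_one_comm.1 h1, h1⟩,
    hH.transpose, ?_⟩
  calc conjTF (J * H.transpose) * (J * H.transpose)
      = conjTF H.transpose * (conjTF J * J) * H.transpose := by
        simp only [conjTF_mul, Matrix.mul_assoc]
    _ = conjTF (V.transpose * H.transpose) * (V.transpose * H.transpose) := by
        rw [h2]; simp only [conjTF_mul, Matrix.mul_assoc]
    _ = 1 := by rw [h1, conjTF_one, Matrix.mul_one]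

theorem exists_unit_postfilter {K : TFMatrix (Fin m) (Fin p ⊕ Fin m)}
    {S : TFMatrix (Fin p ⊕ Fin m) (Fin m)} (hK : IsRHInf K) (hS : IsRHInf S) (h : K * S = 1) :
    IsUnit (K * conjTF K) ∧ ∃ R, IsRHInfUnit R ∧ IsNormalizingPostfilter K R := by
  obtain ⟨V, ⟨hV, H, hH, hVH, hHV⟩, hfac⟩ := exists_isRHInfUnit_spectral_factor hK hS h
  have h1 : conjTF H * H * (K * conjTF K) = 1 := by
    calc conjTF H * H * (K * conjTF K) = conjTF H * ((H * V) * conjTF V) := by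
          rw [hfac]; simp only [Matrix.mul_assoc]
      _ = 1 := by rw [hHV, Matrix.one_mul, ← conjTF_mul, hVH, conjTF_one]
  exact ⟨IsUnit.of_mul_eq_one_right _ h1,
    H, ⟨hH, V, hV, hHV, hVH⟩, hH, (Matrix.inv_eq_left_inv h1).symm⟩

/-- R*(R K K*) = I is a product of square matrices, so its two factors commute. -/
theorem IsNormalizingPostfilter.mul_conjTF_eq_one {K : TFMatrix (Fin m) (Fin p ⊕ Fin m)}
    {R : TFMatrix (Fin m) (Fin m)} (hR : IsNormalizingPostfilter K R)
    (hK : IsUnit (K * conjTF K)) : (R * K) * conjTF (R * K) = 1 := by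
  have h1 : conjTF R * (R * (K * conjTF K)) = 1 := by
    rw [← Matrix.mul_assoc, hR.2]
    exact Matrix.nonsing_inv_mul _ ((Matrix.isUnit_iff_isUnit_det _).1 hK)
  rw [conjTF_mul, ← mul_eq_one_comm.1 h1]
  simp only [Matrix.mul_assoc]

end normalization

/-! ### The perturbed plant -/

section plant

variable {p m : ℕ} {G : TFMatrix (Fin m) (Fin p)}
  {M X : TFMatrix (Fin p) (Fin p)} {N Nh : TFMatrix (Fin m) (Fin p)}
  {Mh Xh : TFMatrix (Fin m) (Fin m)} {Y Yh : TFMatrix (Fin p) (Fin m)}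
  {P : TFMatrix (Fin m) (Fin p ⊕ Fin m)}

namespace IsDoublyCoprime

theorem bezout_blocks (hG : IsDoublyCoprime G M N Mh Nh X Y Xh Yh) :
    Matrix.fromCols X Y * imageRep M N = 1 ∧ Matrix.fromCols X Y * residualRep Xh Yh = 0 ∧
      kernelRep Mh Nh * imageRep M N = 0 ∧ kernelRep Mh Nh * residualRep Xh Yh = 1 := by
  have h := hG.bezout
  rw [Matrix.fromBlocks_multiply, ← Matrix.fromBlocks_one, Matrix.fromBlocks_inj] at h
  simpa only [imageRep, residualRep, kernelRep, Matrix.fromCols_mul_fromRows] using h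

theorem isRHInf_imageRep (hG : IsDoublyCoprime G M N Mh Nh X Y Xh Yh) :
    IsRHInf (imageRep M N) := hG.stable_M.fromRows hG.stable_N

theorem isRHInf_kernelRep (hG : IsDoublyCoprime G M N Mh Nh X Y Xh Yh) :
    IsRHInf (kernelRep Mh Nh) := hG.stable_Nh.neg.fromCols hG.stable_Mh

theorem isRHInf_residualRep (hG : IsDoublyCoprime G M N Mh Nh X Y Xh Yh) :
    IsRHInf (residualRep Xh Yh) := hG.stable_Yh.neg.fromRows hG.stable_Xh

end IsDoublyCoprime

theorem perturbedImageRep_eq :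
    perturbedImageRep M N Xh Yh P =
      imageRep M N + residualRep Xh Yh * privacyPsi M N Xh Yh P := by
  rw [perturbedImageRep, perturbedM, perturbedN, residualRep, Matrix.fromRows_mul, imageRep,
    imageRep]
  ext i j
  rcases i with i | i <;> simp [sub_eq_add_neg]

theorem isRHInf_privacyPsi (hG : IsDoublyCoprime G M N Mh Nh X Y Xh Yh) (hP : IsRHInf P)
    (hstab : IsRHInfUnit (1 - P * residualRep Xh Yh)) : IsRHInf (privacyPsi M N Xh Yh P) := by
  obtain ⟨-, H, hH, h1, -⟩ := hstab
  rw [privacyPsi, Matrix.inv_eq_right_inv h1]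
  exact hH.mul (hP.mul hG.isRHInf_imageRep)

theorem isRHInf_perturbedImageRep (hG : IsDoublyCoprime G M N Mh Nh X Y Xh Yh) (hP : IsRHInf P)
    (hstab : IsRHInfUnit (1 - P * residualRep Xh Yh)) :
    IsRHInf (perturbedImageRep M N Xh Yh P) := by
  rw [perturbedImageRep_eq]
  exact hG.isRHInf_imageRep.add (hG.isRHInf_residualRep.mul (isRHInf_privacyPsi hG hP hstab))

theorem fromCols_mul_perturbedImageRep (hG : IsDoublyCoprime G M N Mh Nh X Y Xh Yh) :
    Matrix.fromCols X Y * perturbedImageRep M N Xh Yh P = 1 := by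
  obtain ⟨h1, h2, -, -⟩ := hG.bezout_blocks
  rw [perturbedImageRep_eq, Matrix.mul_add, h1, ← Matrix.mul_assoc, h2, Matrix.zero_mul, add_zero]

theorem perturbedKernel_mul_residualRep (hG : IsDoublyCoprime G M N Mh Nh X Y Xh Yh) :
    (kernelRep Mh Nh - P) * residualRep Xh Yh = 1 - P * residualRep Xh Yh := by
  rw [Matrix.sub_mul, hG.bezout_blocks.2.2.2]

theorem perturbedKernel_mul_perturbedImageRep (hG : IsDoublyCoprime G M N Mh Nh X Y Xh Yh)
    (hstab : IsRHInfUnit (1 - P * residualRep Xh Yh)) :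
    (kernelRep Mh Nh - P) * perturbedImageRep M N Xh Yh P = 0 := by
  obtain ⟨-, H, -, h1, -⟩ := hstab
  rw [perturbedImageRep_eq, Matrix.mul_add, ← Matrix.mul_assoc, perturbedKernel_mul_residualRep hG,
    privacyPsi, Matrix.inv_eq_right_inv h1, ← Matrix.mul_assoc, h1, Matrix.one_mul, Matrix.sub_mul,
    hG.bezout_blocks.2.2.1, zero_sub, neg_add_cancel]

/-- A stable kernel representation with a stable right inverse, annihilating `[M; N]` with `M`
invertible, comes from a left coprime factorization of `N M⁻¹`. -/
theorem isNormalizedSKR_of_mul_imageRep {K : TFMatrix (Fin m) (Fin p ⊕ Fin m)}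
    {S : TFMatrix (Fin p ⊕ Fin m) (Fin m)} (hK : IsRHInf K) (hS : IsRHInf S) (hKS : K * S = 1)
    (hKK : K * conjTF K = 1) (hM : IsUnit M) (hKJ : K * imageRep M N = 0) :
    IsNormalizedSKR (N * M⁻¹) K := by
  have hKeq : K = kernelRep K.toCols₂ (-K.toCols₁) := by
    rw [kernelRep, neg_neg, Matrix.fromCols_toCols]
  have hSeq : S = residualRep S.toRows₂ (-S.toRows₁) := by
    rw [residualRep, neg_neg, Matrix.fromRows_toRows]
  have hMd : IsUnit M.det := (Matrix.isUnit_iff_isUnit_det _).1 hM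
  have h1 : K.toCols₁ * M + K.toCols₂ * N = 0 := by
    rw [← hKJ, imageRep, ← Matrix.fromCols_mul_fromRows, Matrix.fromCols_toCols]
  have h2 : -K.toCols₁ = K.toCols₂ * (N * M⁻¹) := by
    rw [← Matrix.mul_assoc, eq_neg_of_add_eq_zero_right h1, Matrix.neg_mul,
      Matrix.mul_nonsing_inv_cancel_right _ _ hMd]
  have h3 : K.toCols₁ * S.toRows₁ + K.toCols₂ * S.toRows₂ = 1 := by
    rw [← hKS, ← Matrix.fromCols_mul_fromRows, Matrix.fromCols_toCols, Matrix.fromRows_toRows]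
  -- Substituting K₁ = -K₂NM⁻¹ into K S = I exhibits a right inverse of K₂, so K₂ can serve as the
  -- denominator.
  have h4 : K.toCols₂ * (S.toRows₂ - N * M⁻¹ * S.toRows₁) = 1 := by
    rw [Matrix.mul_sub, ← Matrix.mul_assoc, ← h2, Matrix.neg_mul, sub_neg_eq_add, add_comm, h3]
  have hu : IsUnit K.toCols₂ := IsUnit.of_mul_eq_one _ h4
  refine ⟨K.toCols₂, -K.toCols₁, S.toRows₂, -S.toRows₁, hKeq, fun i j => hK i (Sum.inr j),
    IsRHInf.neg fun i j => hK i (Sum.inl j), fun i j => hS (Sum.inr i) j,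
    IsRHInf.neg fun i j => hS (Sum.inl i) j, hu, ?_, ?_, hKK⟩
  · rw [h2, Matrix.nonsing_inv_mul_cancel_left _ _ ((Matrix.isUnit_iff_isUnit_det _).1 hu)]
  · rw [← hKeq, ← hSeq, hKS]

end plant

end

theorem theorem5p5 {p m : ℕ} (G : TFMatrix (Fin m) (Fin p))
    (M₀ : TFMatrix (Fin p) (Fin p)) (N₀ : TFMatrix (Fin m) (Fin p))
    (Mh₀ : TFMatrix (Fin m) (Fin m)) (Nh₀ : TFMatrix (Fin m) (Fin p))
    (X₀ : TFMatrix (Fin p) (Fin p)) (Y₀ : TFMatrix (Fin p) (Fin m))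
    (Xh₀ : TFMatrix (Fin m) (Fin m)) (Yh₀ : TFMatrix (Fin p) (Fin m))
    (hG : IsDoublyCoprime G M₀ N₀ Mh₀ Nh₀ X₀ Y₀ Xh₀ Yh₀)
    (hI : conjTF (imageRep M₀ N₀) * imageRep M₀ N₀ = 1)
    (hK : kernelRep Mh₀ Nh₀ * conjTF (kernelRep Mh₀ Nh₀) = 1)
    (P : TFMatrix (Fin m) (Fin p ⊕ Fin m)) (hP : IsRHInf P)
    (hstab : IsRHInfUnit (1 - P * residualRep Xh₀ Yh₀)) :
    (∃ Θ₀, IsRHInfUnit Θ₀ ∧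
      IsNormalizingPrefilter (perturbedImageRep M₀ N₀ Xh₀ Yh₀ P) Θ₀) ∧
    (∃ R_N, IsRHInfUnit R_N ∧ IsNormalizingPostfilter (kernelRep Mh₀ Nh₀ - P) R_N) ∧
    ∀ (Θ₀ : TFMatrix (Fin p) (Fin p)) (R_N : TFMatrix (Fin m) (Fin m))
      (P₀ : TFMatrix (Fin m) (Fin p ⊕ Fin m)),
      IsNormalizingPrefilter (perturbedImageRep M₀ N₀ Xh₀ Yh₀ P) Θ₀ →
      IsNormalizingPostfilter (kernelRep Mh₀ Nh₀ - P) R_N →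
      P₀ = R_N * (kernelRep Mh₀ Nh₀ - P) →
      gapL2 (imageRep M₀ N₀) (perturbedImageRep M₀ N₀ Xh₀ Yh₀ P * Θ₀) =
          hInfNorm (P₀ * imageRep M₀ N₀) ∧
        P₀ * conjTF P₀ = 1 ∧
        (IsUnit (perturbedM M₀ N₀ Xh₀ Yh₀ P) → IsRHInfUnit R_N →
          IsNormalizedSKR (perturbedPlant M₀ N₀ Xh₀ Yh₀ P) P₀) := by
  have hJ := isRHInf_perturbedImageRep hG hP hstab
  have hKΔ : IsRHInf (kernelRep Mh₀ Nh₀ - P) := hG.isRHInf_kernelRep.sub hP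
  have hKJ := perturbedKernel_mul_perturbedImageRep hG hstab
  obtain ⟨-, H, hH, hTH, -⟩ := hstab
  have hS : IsRHInf (residualRep Xh₀ Yh₀ * H) := hG.isRHInf_residualRep.mul hH
  have hKS : (kernelRep Mh₀ Nh₀ - P) * (residualRep Xh₀ Yh₀ * H) = 1 := by
    rw [← Matrix.mul_assoc, perturbedKernel_mul_residualRep hG, hTH]
  obtain ⟨hunit, hR⟩ := exists_unit_postfilter hKΔ hS hKS
  refine ⟨exists_unit_prefilter hJ (hG.stable_X.fromCols hG.stable_Y)
    (fromCols_mul_perturbedImageRep hG), hR, ?_⟩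
  rintro Θ R P₀ hΘ hRN rfl
  have hnorm := hRN.mul_conjTF_eq_one hunit
  have hP₀ : IsRHInf (R * (kernelRep Mh₀ Nh₀ - P)) := hRN.1.mul hKΔ
  refine ⟨?_, hnorm, fun hM ⟨_, R', hR', hRR', _⟩ => ?_⟩
  · refine gapL2_eq_hInfNorm hG.isRHInf_imageRep.entriesIn_circleAlg
      (hJ.mul hΘ.1).entriesIn_circleAlg hP₀.entriesIn_circleAlg hΘ.2 hnorm ?_
    rw [Matrix.mul_assoc, ← Matrix.mul_assoc (kernelRep Mh₀ Nh₀ - P), hKJ, Matrix.zero_mul,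
      Matrix.mul_zero]
  -- The inverse of R_N over RH∞ turns the stable right inverse of K_Δ into one of Π₀, which is left
  -- coprimeness.
  · refine isNormalizedSKR_of_mul_imageRep hP₀ (hS.mul hR') ?_ hnorm hM ?_
    · rw [Matrix.mul_assoc, ← Matrix.mul_assoc (kernelRep Mh₀ Nh₀ - P), hKS, Matrix.one_mul, hRR']
    · rw [Matrix.mul_assoc]
      exact (congrArg _ hKJ).trans (Matrix.mul_zero _)
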